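/- All digraphs are finite and without loops. An acyclic $k$-coloring of a digraph $G$ is a map $f:V(G)\to\{1,\dots,k\}$ such that each color class induces a subdigraph without directed cycles. The underlying graph of $G$ has an edge $uv$ whenever $uv$ or $vu$ is an arc of $G$. A tree decomposition of a graph consists of a tree $T$ and bags $X_t\subseteq V(G)$ ($t\in V(T)$) such that every vertex lies in a bag, the two ends of every edge lie in a common bag, and $X_t\cap X_{t'}\subseteq X_{t''}$ whenever $t''$ is on the path between $t$ and $t'$ in $T$; its width is $\max_t|X_t|-1$. It is nice if $T$ is rooted and each node $t$ is a leaf node (no children, $|X_t|=1$), a forget node (exactly one child $t'$, $X_t=X_{t'}\setminus\{v\}$ for a vertex $v$), an introduce node (exactly one child $t'$, $X_t=X_{t'}\cup\{v\}$ for a vertex $v$), or a join node (exactly two children $t_1,t_2$, $X_t=X_{t_1}=X_{t_2}$). **Theorem.** There is an algorithm with the following property. Its input consists of a digraph $G$ on $n$ vertices, a positive integer $k$, and a nice tree decomposition of the underlying graph of $G$, of width $tw$ and with $O(\max(tw,1)\cdot n)$ nodes. It decides whether $G$ has an acyclic $k$-coloring, in time $$O\bigl(k^{tw}\cdot 27^{tw^2}\cdot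 \max(tw,1)^2\cdot n\bigr).$$ Here time is the number of steps of a uniform-cost random access machine with addition and subtraction, $G$ is given by the lists of the out-neighbours of its vertices, and the decomposition by its root, the lists of the children of the nodes and the lists of the elements of the bags. The algorithm depends on nothing, and the constant in the time bound depends only on the constant in the bound on the number of nodes. (For $tw\ge 1$ the time bound is $O(k^{tw}\cdot 27^{tw^2}\cdot tw^2\cdot n)$.) -/

import Mathlib

/-! ## Acyclic colorings of digraphs -/

/-- The subdigraph of `G` induced by `S` is acyclic: no vertex can be reached from itself by a
directed walk with at least one arc that stays inside `S`. -/
def Digraph.IsAcyclicOn {V : Type*} (G : Digraph V) (S : Set V) : Prop :=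
  ∀ v, ¬ Relation.TransGen (fun a b => a ∈ S ∧ b ∈ S ∧ G.Adj a b) v v

/-- `G` has an acyclic `k`-coloring: its vertices can be colored with `k` colors (not all of which
have to be used) such that every color class induces an acyclic subdigraph. -/
def Digraph.AcyclicColorable {V : Type*} (G : Digraph V) (k : ℕ) : Prop :=
  ∃ f : V → Fin k, ∀ c : Fin k, G.IsAcyclicOn {v | f v = c}

/-! ## Nice tree decompositions -/

/-- A tree decomposition of the graph `G`, with node set `ι`. -/
structure TreeDecomposition {V : Type*} (G : SimpleGraph V) (ι : Type*) where
  tree : SimpleGraph ι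
  isTree : tree.IsTree
  bag : ι → Finset V
  vertex_mem : ∀ v : V, ∃ t, v ∈ bag t
  edge_mem : ∀ u v : V, G.Adj u v → ∃ t, u ∈ bag t ∧ v ∈ bag t
  path_mem : ∀ (t t' : ι) (p : tree.Walk t t'), p.IsPath →
    ∀ t'' ∈ p.support, ∀ v ∈ bag t, v ∈ bag t' → v ∈ bag t''

/-- The width of a tree decomposition: the largest size of a bag, minus one. -/
def TreeDecomposition.width {V ι : Type*} [Fintype ι] {G : SimpleGraph V}
    (D : TreeDecomposition G ι) : ℕ :=
  (Finset.univ.sup fun t => (D.bag t).card) - 1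

/-- The children of the node `t`, when the tree is rooted at `r`: the neighbours of `t` that are
farther away from `r` than `t`. -/
def TreeDecomposition.children {V ι : Type*} {G : SimpleGraph V}
    (D : TreeDecomposition G ι) (r t : ι) : Set ι :=
  {t' | D.tree.Adj t t' ∧ D.tree.dist r t < D.tree.dist r t'}

/-- A nice tree decomposition: a tree decomposition with a root such that every node is a leaf
node, a forget node, an introduce node or a join node. -/
structure NiceTreeDecomposition {V : Type*} [DecidableEq V] (G : SimpleGraph V) (ι : Type*)
    extends TreeDecomposition G ι where
  root : ι
  nice : ∀ t : ι,
    (toTreeDecomposition.children root t = ∅ ∧ ∃ v, bag t = {v}) ∨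
    (∃ t' v, toTreeDecomposition.children root t = {t'} ∧ bag t = bag t' \ {v}) ∨
    (∃ t' v, toTreeDecomposition.children root t = {t'} ∧ bag t = bag t' ∪ {v}) ∨
    (∃ t₁ t₂, t₁ ≠ t₂ ∧ toTreeDecomposition.children root t = {t₁, t₂} ∧
      bag t = bag t₁ ∧ bag t = bag t₂)

/-! ## Random access machines

The machine model is the uniform-cost random access machine whose arithmetic consists of addition
and subtraction, programmed with structured control flow. Its store consists of registers and of
unbounded arrays, all holding natural numbers; a program names only finitely many of them.
There is no multiplication, so that no huge numbers can be built in few steps. -/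

namespace RAM

/-- The store of the machine. -/
structure State where
  reg : ℕ → ℕ
  arr : ℕ → ℕ → ℕ

/-- Expressions: constants, registers, array cells, sums, and differences (truncated at `0`). -/
inductive Expr where
  | const (c : ℕ)
  | reg (x : ℕ)
  | read (a : ℕ) (i : Expr)
  | add (e₁ e₂ : Expr)
  | sub (e₁ e₂ : Expr)

/-- The value of an expression. -/
def Expr.eval (s : State) : Expr → ℕ
  | .const c => c
  | .reg x => s.reg x
  | .read a i => s.arr a (i.eval s)
  | .add e₁ e₂ => e₁.eval s + e₂.eval s
  | .sub e₁ e₂ => e₁.eval s - e₂.eval s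

/-- The number of steps that it takes to evaluate an expression: one for each constant, register
access, array access and arithmetic operation. -/
def Expr.cost : Expr → ℕ
  | .const _ => 1
  | .reg _ => 1
  | .read _ i => i.cost + 1
  | .add e₁ e₂ => e₁.cost + e₂.cost + 1
  | .sub e₁ e₂ => e₁.cost + e₂.cost + 1

/-- Programs. A test succeeds when the value of its expression is nonzero. -/
inductive Program where
  | skip
  | assign (x : ℕ) (e : Expr)
  | write (a : ℕ) (i e : Expr)
  | seq (P Q : Program)
  | ite (e : Expr) (P Q : Program)
  | loop (e : Expr) (P : Program)

/-- Change the content of register `x` to `v`. -/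
def State.setReg (s : State) (x v : ℕ) : State :=
  { s with reg := Function.update s.reg x v }

/-- Change the content of cell `i` of array `a` to `v`. -/
def State.setArr (s : State) (a i v : ℕ) : State :=
  { s with arr := Function.update s.arr a (Function.update (s.arr a) i v) }

/-- `Runs P s s' t`: started on the store `s`, the program `P` halts after exactly `t` steps with
the store `s'`. -/
inductive Runs : Program → State → State → ℕ → Prop where
  | skip (s : State) : Runs .skip s s 1
  | assign (s : State) (x : ℕ) (e : Expr) :
      Runs (.assign x e) s (s.setReg x (e.eval s)) (e.cost + 1)
  | write (s : State) (a : ℕ) (i e : Expr) :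
      Runs (.write a i e) s (s.setArr a (i.eval s) (e.eval s)) (i.cost + e.cost + 1)
  | seq {P Q : Program} {s s' s'' : State} {t t' : ℕ} :
      Runs P s s' t → Runs Q s' s'' t' → Runs (.seq P Q) s s'' (t + t')
  | ite_true {e : Expr} {P Q : Program} {s s' : State} {t : ℕ} :
      e.eval s ≠ 0 → Runs P s s' t → Runs (.ite e P Q) s s' (e.cost + 1 + t)
  | ite_false {e : Expr} {P Q : Program} {s s' : State} {t : ℕ} :
      e.eval s = 0 → Runs Q s s' t → Runs (.ite e P Q) s s' (e.cost + 1 + t)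
  | loop_true {e : Expr} {P : Program} {s s' s'' : State} {t t' : ℕ} :
      e.eval s ≠ 0 → Runs P s s' t → Runs (.loop e P) s' s'' t' →
        Runs (.loop e P) s s'' (e.cost + 1 + t + t')
  | loop_false {e : Expr} {P : Program} {s : State} :
      e.eval s = 0 → Runs (.loop e P) s s (e.cost + 1)

/-- The machine is deterministic. -/
theorem Runs.deterministic {P : Program} {s s₁ : State} {t₁ : ℕ} (h₁ : Runs P s s₁ t₁) :
    ∀ {s₂ : State} {t₂ : ℕ}, Runs P s s₂ t₂ → s₁ = s₂ ∧ t₁ = t₂ := by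
  induction h₁ with
  | skip | assign | write =>
    intro s₂ t₂ h₂
    cases h₂
    exact ⟨rfl, rfl⟩
  | seq _ _ ih ih' =>
    intro s₂ t₂ h₂
    cases h₂ with
    | seq h h' =>
      obtain ⟨rfl, rfl⟩ := ih h
      obtain ⟨rfl, rfl⟩ := ih' h'
      exact ⟨rfl, rfl⟩
  | ite_true he _ ih | ite_false he _ ih =>
    intro s₂ t₂ h₂
    cases h₂ with
    | ite_true he' h =>
      first
      | exact absurd he he'
      | (obtain ⟨rfl, rfl⟩ := ih h; exact ⟨rfl, rfl⟩)
    | ite_false he' h =>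
      first
      | exact absurd he' he
      | (obtain ⟨rfl, rfl⟩ := ih h; exact ⟨rfl, rfl⟩)
  | loop_true he _ _ ih ih' =>
    intro s₂ t₂ h₂
    cases h₂ with
    | loop_true _ h h' =>
      obtain ⟨rfl, rfl⟩ := ih h
      obtain ⟨rfl, rfl⟩ := ih' h'
      exact ⟨rfl, rfl⟩
    | loop_false he' => exact absurd he' he
  | loop_false he =>
    intro s₂ t₂ h₂
    cases h₂ with
    | loop_true he' => exact absurd he he'
    | loop_false => exact ⟨rfl, rfl⟩

/-- Started on `s`, the program `P` halts within `b` steps, and register `0` then holds the answer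
to the question whether `q` holds: `1` for yes and `0` for no. -/
def DecidesWithin (P : Program) (s : State) (q : Prop) (b : ℕ) : Prop :=
  ∃ s' t, Runs P s s' t ∧ t ≤ b ∧ (q → s'.reg 0 = 1) ∧ (¬ q → s'.reg 0 = 0)

/-- The cells `start, …, start + len - 1` of an array list the elements of `S`, each of them
once, in some order. -/
def Lists {m : ℕ} (cells : ℕ → ℕ) (start len : ℕ) (S : Set (Fin m)) : Prop :=
  ∃ L : List (Fin m), L.Nodup ∧ (∀ v, v ∈ L ↔ v ∈ S) ∧ L.length = len ∧
    ∀ (j : ℕ) (h : j < L.length), cells (start + j) = (L[j] : ℕ)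

/-- The store `s` holds the digraph `G`, the nice tree decomposition `D` and the number `k`, and
nothing else. Registers `0, …, 3` hold the number of vertices, the number of nodes, `k` and the
root. The digraph is stored by the lists of the out-neighbours of its vertices, the rooted tree by
the lists of the children of its nodes, and the bags by the lists of their elements. For each of
these three kinds of lists, one array holds the starting points of the lists, a second array their
lengths and a third array their entries. -/
structure IsInput (s : State) {n N : ℕ} (G : Digraph (Fin n))
    (D : NiceTreeDecomposition G.toSimpleGraphInclusive (Fin N)) (k : ℕ) : Prop where
  numVertices : s.reg 0 = n
  numNodes : s.reg 1 = N
  numColors : s.reg 2 = k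
  root : s.reg 3 = (D.root : ℕ)
  arcs : ∀ u : Fin n, Lists (s.arr 2) (s.arr 0 u) (s.arr 1 u) {v | G.Adj u v}
  children : ∀ t : Fin N, Lists (s.arr 5) (s.arr 3 t) (s.arr 4 t)
    (D.toTreeDecomposition.children D.root t)
  bags : ∀ t : Fin N, Lists (s.arr 8) (s.arr 6 t) (s.arr 7 t) {v | v ∈ D.bag t}
  reg_eq_zero : ∀ x, 4 ≤ x → s.reg x = 0
  arr_eq_zero : ∀ a, 9 ≤ a → ∀ i, s.arr a i = 0

end RAM

namespace RAM

/-! ### Stores and frames -/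

/-! A coloring `f` is acyclic exactly when some ranking `ρ` of the vertices satisfies `ρ u < ρ v`
for every arc `uv` with `f u = f v` (`AcyclicColorable.exists_rank`, `acyclicColorable_of_rank`).
These conditions concern single vertices and single arcs, hence single bags, and only the order that
`ρ` induces on a bag matters. So a state of a bag gives a color and a small rank to each of its
positions. It is valid if monochromatic arcs inside the bag go up, and states at a node and its
child are compatible if they agree in color and in order on the common vertices. A global pair
restricts to such states by counting the smaller elements of each bag
(`Represents.exists_feasible`). Conversely, compatible valid states are glued from the root
downwards: the values of common vertices are kept, and the other vertices of the child are fitted in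
because the ranks may be taken in the dense order `ℚ` (`exists_order_extension`,
`exists_forall_good`, `Represents.acyclicColorable`).

Let `w` be the width and `m = w + 1`. If `k ≥ m`, there is a coloring that is injective on every
bag, and the answer is yes (`acyclicColorable_of_card_bag_le`). Otherwise colors and ranks are
digits in base `m`, so there are `S = m ^ (2 * m)` states, and a brute-force evaluation of the
recursion takes `O(S ^ 7)` steps per node. As `S ^ 7` is only `2 ^ O(w log w)`, it is `O(27 ^ w ^
2)` (`exists_pow_le_mul_pow`); the factor `k ^ w` and one factor `max w 1` are not even needed.
Niceness enters only through the bound of two children per node.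

On the machine side, `Within` is a program logic for total correctness with time bounds. The
recursion is written as a formula with bounded quantifiers, and the compilation of such formulas is
verified once and for all (`Formula.within_compile`). The lack of multiplication is made up for by
tables of multiples and of digits that are filled by additions. -/

@[simp] theorem State.setReg_reg (s : State) (x v y : ℕ) :
    (s.setReg x v).reg y = if y = x then v else s.reg y := by
  simp [State.setReg, Function.update_apply]

@[simp] theorem State.setReg_arr (s : State) (x v : ℕ) : (s.setReg x v).arr = s.arr := rfl

@[simp] theorem State.setArr_reg (s : State) (a i v : ℕ) : (s.setArr a i v).reg = s.reg := rfl

@[simp] theorem State.setArr_arr (s : State) (a i v b : ℕ) :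
    (s.setArr a i v).arr b = if b = a then Function.update (s.arr a) i v else s.arr b := by
  simp only [State.setArr, Function.update_apply]

/-- The registers that a program may write to. -/
def Program.wregs : Program → List ℕ
  | .skip => []
  | .assign x _ => [x]
  | .write _ _ _ => []
  | .seq P Q => P.wregs ++ Q.wregs
  | .ite _ P Q => P.wregs ++ Q.wregs
  | .loop _ P => P.wregs

/-- The arrays that a program may write to. -/
def Program.warrs : Program → List ℕ
  | .skip => []
  | .assign _ _ => []
  | .write a _ _ => [a]
  | .seq P Q => P.warrs ++ Q.warrs
  | .ite _ P Q => P.warrs ++ Q.warrs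
  | .loop _ P => P.warrs

/-- Two stores agree outside of the registers and arrays that `P` may write to. -/
def Agree (P : Program) (s s' : State) : Prop :=
  (∀ x, x ∉ P.wregs → s'.reg x = s.reg x) ∧ ∀ a, a ∉ P.warrs → s'.arr a = s.arr a

theorem Agree.refl (P : Program) (s : State) : Agree P s s := ⟨fun _ _ => rfl, fun _ _ => rfl⟩

theorem Agree.trans {P : Program} {s s' s'' : State} (h : Agree P s s') (h' : Agree P s' s'') :
    Agree P s s'' :=
  ⟨fun x hx => (h'.1 x hx).trans (h.1 x hx), fun x hx => (h'.2 x hx).trans (h.2 x hx)⟩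

theorem Agree.mono {P Q : Program} {s s' : State} (h : Agree P s s')
    (hr : P.wregs ⊆ Q.wregs) (ha : P.warrs ⊆ Q.warrs) : Agree Q s s' :=
  ⟨fun x hx => h.1 x fun hx' => hx (hr hx'), fun x hx => h.2 x fun hx' => hx (ha hx')⟩

/-- The frame rule. The lists of written registers and arrays are read off from the syntax, so for
concrete programs `decide` shows that a cell is untouched. -/
theorem Runs.agree {P : Program} {s s' : State} {t : ℕ} (h : Runs P s s' t) : Agree P s s' := by
  induction h with
  | skip => exact Agree.refl _ _
  | assign s x e =>
    refine ⟨fun y hy => ?_, fun _ _ => rfl⟩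
    simp only [Program.wregs, List.mem_singleton] at hy
    simp [hy]
  | write s a i e =>
    refine ⟨fun _ _ => rfl, fun y hy => ?_⟩
    simp only [Program.warrs, List.mem_singleton] at hy
    simp [hy]
  | seq _ _ ih ih' =>
    exact (ih.mono (by simp [Program.wregs]) (by simp [Program.warrs])).trans
      (ih'.mono (by simp [Program.wregs]) (by simp [Program.warrs]))
  | ite_true _ _ ih => exact ih.mono (by simp [Program.wregs]) (by simp [Program.warrs])
  | ite_false _ _ ih => exact ih.mono (by simp [Program.wregs]) (by simp [Program.warrs])
  | loop_true _ _ _ ih ih' =>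
    exact (ih.mono (by simp [Program.wregs]) (by simp [Program.warrs])).trans ih'
  | loop_false => exact Agree.refl _ _

/-! ### Total correctness with a time bound -/

/-- Started on `s`, the program `P` halts within `K` steps on a store with the property `Q`. -/
def Within (P : Program) (s : State) (K : ℕ) (Q : State → Prop) : Prop :=
  ∃ s' t, Runs P s s' t ∧ t ≤ K ∧ Q s'

theorem Within.mono {P : Program} {s : State} {K K' : ℕ} {Q Q' : State → Prop}
    (h : Within P s K Q) (hK : K ≤ K') (hQ : ∀ s', Agree P s s' → Q s' → Q' s') :
    Within P s K' Q' := by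
  obtain ⟨s', t, hr, ht, hq⟩ := h
  exact ⟨s', t, hr, ht.trans hK, hQ s' hr.agree hq⟩

theorem Within.skip {s : State} {Q : State → Prop} (h : Q s) : Within .skip s 1 Q :=
  ⟨s, 1, .skip s, le_rfl, h⟩

theorem Within.assign {s : State} {x : ℕ} {e : Expr} {Q : State → Prop}
    (h : Q (s.setReg x (e.eval s))) : Within (.assign x e) s (e.cost + 1) Q :=
  ⟨_, _, .assign s x e, le_rfl, h⟩

theorem Within.write {s : State} {a : ℕ} {i e : Expr} {Q : State → Prop}
    (h : Q (s.setArr a (i.eval s) (e.eval s))) :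
    Within (.write a i e) s (i.cost + e.cost + 1) Q :=
  ⟨_, _, .write s a i e, le_rfl, h⟩

/-- The nested postcondition lets a sequence be executed symbolically, one instruction after the
other. -/
theorem Within.seq {P P' : Program} {s : State} {K K' : ℕ} {Q : State → Prop}
    (h : Within P s K fun s' => Within P' s' K' Q) : Within (.seq P P') s (K + K') Q := by
  obtain ⟨s', t, hr, ht, s'', t', hr', ht', hq⟩ := h
  exact ⟨s'', t + t', .seq hr hr', add_le_add ht ht', hq⟩

theorem Within.ite {e : Expr} {P P' : Program} {s : State} {K : ℕ} {Q : State → Prop}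
    (h : e.eval s ≠ 0 → Within P s K Q) (h' : e.eval s = 0 → Within P' s K Q) :
    Within (.ite e P P') s (e.cost + 1 + K) Q := by
  by_cases he : e.eval s = 0
  · obtain ⟨s', t, hr, ht, hq⟩ := h' he
    exact ⟨s', _, .ite_false he hr, by omega, hq⟩
  · obtain ⟨s', t, hr, ht, hq⟩ := h he
    exact ⟨s', _, .ite_true he hr, by omega, hq⟩

/-- Run `P` with the values `0, 1, …` of the register `x`, as long as they are below `e`. -/
def Program.for (x : ℕ) (e : Expr) (P : Program) : Program :=
  .seq (.assign x (.const 0))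
    (.loop (.sub e (.reg x)) (.seq P (.assign x (.add (.reg x) (.const 1)))))

/-- The invariant rule. Loop bodies are only considered on stores that agree with the initial one
outside the loop's own writes, so invariants need not mention unchanged data. The constants are 2
for the initialization and `e.cost + 3` for the failing test; each round adds `e.cost + 3` for its
test and 4 for the increment. -/
theorem Within.for {x : ℕ} {e : Expr} {P : Program} {s : State} {n : ℕ} {K : ℕ → ℕ}
    (I : ℕ → State → Prop) (hx : x ∉ P.wregs)
    (he : ∀ s', Agree (.for x e P) s s' → e.eval s' = n) (h0 : I 0 (s.setReg x 0))
    (hstep : ∀ i < n, ∀ s', Agree (.for x e P) s s' → s'.reg x = i → I i s' →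
      Within P s' (K i) fun s'' => I (i + 1) (s''.setReg x (i + 1))) :
    Within (.for x e P) s (e.cost + 5 + ∑ i ∈ Finset.range n, (K i + e.cost + 7)) (I n) := by
  -- Induction on the number `d` of remaining rounds.
  have key : ∀ d i, i + d = n → ∀ s', Agree (.for x e P) s s' → s'.reg x = i → I i s' →
      Within (.loop (.sub e (.reg x)) (.seq P (.assign x (.add (.reg x) (.const 1))))) s'
        (e.cost + 3 + ∑ j ∈ Finset.Ico i n, (K j + e.cost + 7)) (I n) := by
    intro d
    induction d with
    | zero =>
      intro i hi s' ha hr hI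
      obtain rfl : i = n := by omega
      exact ⟨s', _, .loop_false (by simp [Expr.eval, he s' ha, hr]), by simp [Expr.cost], hI⟩
    | succ d ih =>
      intro i hi s' ha hr hI
      obtain ⟨s'', t, hrun, ht, hI'⟩ := hstep i (by omega) s' ha hr hI
      have hx' : s''.reg x = i := by rw [hrun.agree.1 x hx, hr]
      have hrun' := Runs.seq hrun (.assign s'' x (.add (.reg x) (.const 1)))
      have hev : (Expr.add (.reg x) (.const 1)).eval s'' = i + 1 := by simp [Expr.eval, hx']
      rw [hev] at hrun'
      have ha' : Agree (.for x e P) s (s''.setReg x (i + 1)) :=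
        ha.trans (hrun'.agree.mono (by simp [Program.for, Program.wregs])
          (by simp [Program.for, Program.warrs]))
      obtain ⟨s₃, t', hr₃, ht', hI₃⟩ := ih (i + 1) (by omega) _ ha' (by simp) hI'
      refine ⟨s₃, _, .loop_true (by simp [Expr.eval, he s' ha, hr]; omega) hrun' hr₃, ?_, hI₃⟩
      rw [Finset.sum_eq_sum_Ico_succ_bot (by omega : i < n)]
      simp only [Expr.cost]
      omega
  have ha : Agree (.for x e P) s (s.setReg x 0) :=
    (Runs.assign s x (.const 0)).agree.mono (by simp [Program.for, Program.wregs])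
      (by simp [Program.warrs])
  obtain ⟨s', t, hr, ht, hI⟩ := key n 0 (by omega) _ ha (by simp) h0
  refine ⟨s', _, .seq (.assign s x (.const 0)) hr, ?_, hI⟩
  simp only [Expr.cost, Finset.range_eq_Ico]
  omega

/-! ### Formulas with bounded quantifiers -/

/-- Formulas with bounded quantifiers over natural numbers. A formula is used together with a
number `b`; the quantifiers then bind the registers from `b` on. -/
inductive Formula where
  | atom (e : Expr)
  | neg (φ : Formula)
  | and (φ ψ : Formula)
  | ex (e : Expr) (φ : Formula)

/-- The meaning of a formula. -/
def Formula.Holds : Formula → ℕ → State → Prop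
  | .atom e, _, s => e.eval s ≠ 0
  | .neg φ, b, s => ¬ φ.Holds b s
  | .and φ ψ, b, s => φ.Holds b s ∧ ψ.Holds b s
  | .ex e φ, b, s => ∃ v < e.eval s, φ.Holds (b + 1) (s.setReg b v)

/-- A program that evaluates a formula; it leaves the result in the register `0`. -/
def Formula.compile : Formula → ℕ → Program
  | .atom e, _ => .assign 0 e
  | .neg φ, b => .seq (φ.compile b) (.assign 0 (.sub (.const 1) (.reg 0)))
  | .and φ ψ, b => .seq (φ.compile b) (.ite (.reg 0) (ψ.compile b) .skip)
  | .ex e φ, b => .seq (.assign 0 (.const 0)) (.seq (.assign b (.const 0))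
      (.loop (.sub e (.reg b)) (.seq (φ.compile (b + 1))
        (.ite (.reg 0) (.assign b e) (.assign b (.add (.reg b) (.const 1)))))))

/-- The registers of an expression lie strictly between `0` and `b`. -/
def Expr.regsBelow (b : ℕ) : Expr → Bool
  | .const _ => true
  | .reg x => decide (0 < x) && decide (x < b)
  | .read _ i => i.regsBelow b
  | .add e₁ e₂ => e₁.regsBelow b && e₂.regsBelow b
  | .sub e₁ e₂ => e₁.regsBelow b && e₂.regsBelow b

/-- The free registers of a formula lie strictly between `0` and `b`. -/
def Formula.regsBelow : ℕ → Formula → Bool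
  | b, .atom e => e.regsBelow b
  | b, .neg φ => φ.regsBelow b
  | b, .and φ ψ => φ.regsBelow b && ψ.regsBelow b
  | b, .ex e φ => e.regsBelow b && φ.regsBelow (b + 1)

/-- The ranges of the quantifiers of a formula have at most `B` elements. -/
def Formula.Bounded (B : ℕ) : Formula → ℕ → State → Prop
  | .atom _, _, _ => True
  | .neg φ, b, s => φ.Bounded B b s
  | .and φ ψ, b, s => φ.Bounded B b s ∧ ψ.Bounded B b s
  | .ex e φ, b, s => e.eval s ≤ B ∧ ∀ v < e.eval s, φ.Bounded B (b + 1) (s.setReg b v)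

/-- A bound for the time to evaluate a formula all of whose quantifiers have ranges with at most
`B` elements. -/
def Formula.time (B : ℕ) : Formula → ℕ
  | .atom e => e.cost + 1
  | .neg φ => φ.time B + 4
  | .and φ ψ => φ.time B + (ψ.time B + 3)
  | .ex e φ => e.cost + 7 + B * (φ.time B + 2 * e.cost + 9)

/-- Two stores agree on the arrays and on the registers strictly between `0` and `b`. -/
def AgreeBelow (b : ℕ) (s s' : State) : Prop :=
  s'.arr = s.arr ∧ ∀ x, 0 < x → x < b → s'.reg x = s.reg x

theorem AgreeBelow.trans {b : ℕ} {s s' s'' : State} (h : AgreeBelow b s s')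
    (h' : AgreeBelow b s' s'') : AgreeBelow b s s'' :=
  ⟨h'.1.trans h.1, fun x h₁ h₂ => (h'.2 x h₁ h₂).trans (h.2 x h₁ h₂)⟩

theorem AgreeBelow.setReg_right {b x v : ℕ} {s s' : State} (h : AgreeBelow b s s')
    (hx : x = 0 ∨ b ≤ x) : AgreeBelow b s (s'.setReg x v) := by
  refine ⟨h.1, fun y h₁ h₂ => ?_⟩
  rw [State.setReg_reg, if_neg (by omega), h.2 y h₁ h₂]

theorem AgreeBelow.setReg_both {b v : ℕ} {s s' : State} (h : AgreeBelow b s s') :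
    AgreeBelow (b + 1) (s.setReg b v) (s'.setReg b v) := by
  refine ⟨h.1, fun y h₁ h₂ => ?_⟩
  simp only [State.setReg_reg]
  split_ifs with hy
  · rfl
  · exact h.2 y h₁ (by omega)

theorem Expr.eval_congr {b : ℕ} {s s' : State} (h : AgreeBelow b s s') {e : Expr}
    (he : e.regsBelow b) : e.eval s' = e.eval s := by
  induction e with
  | const c => rfl
  | reg x =>
    simp only [Expr.regsBelow, Bool.and_eq_true, decide_eq_true_eq] at he
    exact h.2 x he.1 he.2
  | read a i ih => simp only [Expr.eval, h.1, ih he]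
  | add e₁ e₂ ih₁ ih₂ | sub e₁ e₂ ih₁ ih₂ =>
    simp only [Expr.regsBelow, Bool.and_eq_true] at he
    simp only [Expr.eval, ih₁ he.1, ih₂ he.2]

/-- Evaluating a formula disturbs register `0` and the quantifier registers from `b` on; this makes
the disturbance harmless for what is evaluated next. -/
theorem Formula.holds_congr {φ : Formula} : ∀ {b : ℕ} {s s' : State}, AgreeBelow b s s' →
    φ.regsBelow b → (φ.Holds b s' ↔ φ.Holds b s) := by
  induction φ with
  | atom e =>
    intro b s s' h he
    simp only [Formula.Holds, Expr.eval_congr h he]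
  | neg φ ih =>
    intro b s s' h he
    simp only [Formula.Holds, ih h he]
  | and φ ψ ih ih' =>
    intro b s s' h he
    simp only [Formula.regsBelow, Bool.and_eq_true] at he
    simp only [Formula.Holds, ih h he.1, ih' h he.2]
  | ex e φ ih =>
    intro b s s' h he
    simp only [Formula.regsBelow, Bool.and_eq_true] at he
    simp only [Formula.Holds, Expr.eval_congr h he.1, ih h.setReg_both he.2]

theorem Formula.bounded_congr {B : ℕ} {φ : Formula} : ∀ {b : ℕ} {s s' : State},
    AgreeBelow b s s' → φ.regsBelow b → (φ.Bounded B b s' ↔ φ.Bounded B b s) := by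
  induction φ with
  | atom e => exact fun _ _ => Iff.rfl
  | neg φ ih =>
    intro b s s' h he
    simp only [Formula.Bounded, ih h he]
  | and φ ψ ih ih' =>
    intro b s s' h he
    simp only [Formula.regsBelow, Bool.and_eq_true] at he
    simp only [Formula.Bounded, ih h he.1, ih' h he.2]
  | ex e φ ih =>
    intro b s s' h he
    simp only [Formula.regsBelow, Bool.and_eq_true] at he
    simp only [Formula.Bounded, Expr.eval_congr h he.1, ih h.setReg_both he.2]

theorem Formula.within_compile {B : ℕ} {φ : Formula} : ∀ {b : ℕ} {s : State}, 0 < b →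
    φ.regsBelow b → φ.Bounded B b s →
    Within (φ.compile b) s (φ.time B) fun s' =>
      AgreeBelow b s s' ∧ (s'.reg 0 ≠ 0 ↔ φ.Holds b s) := by
  induction φ with
  | atom e =>
    intro b s hb he _
    exact .assign ⟨.setReg_right ⟨rfl, fun _ _ _ => rfl⟩ (.inl rfl), by simp [Formula.Holds]⟩
  | neg φ ih =>
    intro b s hb he hB
    refine .seq ((ih hb he hB).mono le_rfl fun s' _ h => .assign ⟨h.1.setReg_right (.inl rfl), ?_⟩)
    simp only [State.setReg_reg, Expr.eval, Formula.Holds, ← h.2, if_true]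
    omega
  | and φ ψ ih ih' =>
    intro b s hb he hB
    simp only [Formula.regsBelow, Bool.and_eq_true] at he
    refine .seq ((ih hb he.1 hB.1).mono le_rfl fun s' _ h => ?_)
    refine (Within.ite (K := ψ.time B + 1) (fun h0 => ?_) (fun h0 => ?_)).mono
      (by simp [Expr.cost]; omega) fun _ _ h => h
    · have hB' := (Formula.bounded_congr h.1 he.2).2 hB.2
      refine (ih' hb he.2 hB').mono (by omega) fun s'' _ h' => ⟨h.1.trans h'.1, ?_⟩
      rw [h'.2, Formula.holds_congr h.1 he.2]
      simp only [Formula.Holds, ← h.2, Expr.eval] at *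
      tauto
    · refine (Within.skip ?_).mono (by omega) fun _ _ h => h
      refine ⟨h.1, ?_⟩
      simp only [Formula.Holds, ← h.2, Expr.eval] at *
      tauto
  | ex e φ ih =>
    intro b s hb he hB
    simp only [Formula.regsBelow, Bool.and_eq_true] at he
    -- While the search runs, register `0` is zero and no value below `i` is a witness; `d`
    -- candidates remain.
    have key : ∀ d i s', i + d = e.eval s → AgreeBelow b s s' → s'.reg b = i → s'.reg 0 = 0 →
        (∀ v < i, ¬ φ.Holds (b + 1) (s.setReg b v)) →
        Within (.loop (.sub e (.reg b)) (.seq (φ.compile (b + 1))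
          (.ite (.reg 0) (.assign b e) (.assign b (.add (.reg b) (.const 1)))))) s'
          (e.cost + 3 + d * (φ.time B + 2 * e.cost + 9))
          fun s' => AgreeBelow b s s' ∧ (s'.reg 0 ≠ 0 ↔ (Formula.ex e φ).Holds b s) := by
      intro d
      induction d with
      | zero =>
        intro i s' hi ha hr h0 hI
        refine ⟨s', _, .loop_false (by simp [Expr.eval, Expr.eval_congr ha he.1, hr]; omega),
          by simp [Expr.cost], ha, ?_⟩
        simp only [h0, Formula.Holds, ne_eq, not_true, false_iff, not_exists, not_and]
        exact fun v hv => hI v (by omega)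
      | succ d ihd =>
        intro i s' hi ha hr h0 hI
        have hag : AgreeBelow (b + 1) (s.setReg b i) s' := by
          refine ⟨ha.1, fun y h₁ h₂ => ?_⟩
          simp only [State.setReg_reg]
          split_ifs with hy
          · rw [hy, hr]
          · exact ha.2 y h₁ (by omega)
        have hB' := (Formula.bounded_congr hag he.2).2 (hB.2 i (by omega))
        obtain ⟨s₂, t, hrun, ht, ha₂, h₂⟩ := ih (by omega) he.2 hB'
        rw [Formula.holds_congr hag he.2] at h₂
        have ha' : AgreeBelow b s s₂ :=
          ha.trans ⟨ha₂.1, fun x h₁ h₂ => ha₂.2 x h₁ (by omega)⟩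
        have hne : (Expr.sub e (.reg b)).eval s' ≠ 0 := by
          simp [Expr.eval, Expr.eval_congr ha he.1, hr]; omega
        have hrb : s₂.reg b = i := by rw [ha₂.2 b hb (by omega), hr]
        by_cases hs : s₂.reg 0 = 0
        · have hr₂ := Runs.ite_false (e := .reg 0) (P := .assign b e) hs
            (.assign s₂ b (.add (.reg b) (.const 1)))
          have hev : (Expr.add (.reg b) (.const 1)).eval s₂ = i + 1 := by simp [Expr.eval, hrb]
          rw [hev] at hr₂
          obtain ⟨s₃, t', hr₃, ht', hQ⟩ := ihd (i + 1) (s₂.setReg b (i + 1)) (by omega)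
            (ha'.setReg_right (.inr le_rfl)) (by simp)
            (by rw [State.setReg_reg, if_neg (by omega), hs]) (by
              intro v hv
              rcases Nat.lt_succ_iff_lt_or_eq.1 hv with hv | rfl
              · exact hI v hv
              · rw [← h₂]; simp [hs])
          refine ⟨s₃, _, .loop_true hne (.seq hrun hr₂) hr₃, ?_, hQ⟩
          simp only [Expr.cost, Nat.add_mul] at *
          omega
        -- A witness is found: setting the counter to its bound makes the next test fail, which ends
        -- the search with register `0` still nonzero.
        · have hr₂ := Runs.ite_true (e := .reg 0)
            (Q := .assign b (.add (.reg b) (.const 1))) hs (.assign s₂ b e)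
          have hev : e.eval s₂ = e.eval s := Expr.eval_congr ha' he.1
          rw [hev] at hr₂
          refine ⟨s₂.setReg b (e.eval s), _, .loop_true hne (.seq hrun hr₂) (.loop_false ?_), ?_,
            ha'.setReg_right (.inr le_rfl), ?_⟩
          · simp [Expr.eval, Expr.eval_congr (ha'.setReg_right (.inr le_rfl)) he.1]
          · simp only [Expr.cost, Nat.add_mul] at *
            omega
          · have : (s₂.setReg b (e.eval s)).reg 0 ≠ 0 := by
              rw [State.setReg_reg, if_neg (by omega)]; exact hs
            simp only [this, ne_eq, not_false_eq_true, true_iff]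
            exact ⟨i, by omega, h₂.1 hs⟩
    have hag : AgreeBelow b s ((s.setReg 0 0).setReg b 0) :=
      .setReg_right (.setReg_right ⟨rfl, fun _ _ _ => rfl⟩ (.inl rfl)) (.inr le_rfl)
    refine (Within.seq (.assign (.seq (.assign (key (e.eval s) 0 _ (by omega) hag ?_ ?_ ?_))))).mono
      ?_ fun _ _ h => h
    · simp [Expr.eval]
    · simp [Expr.eval]
    · simp
    · have := Nat.mul_le_mul_right (φ.time B + 2 * e.cost + 9) hB.1
      simp only [Expr.cost, Formula.time]
      omega

end RAM

/-! ### Rooted tree decompositions -/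

namespace TreeDecomposition

variable {V ι : Type*} {G : SimpleGraph V} (D : TreeDecomposition G ι)

/-- By uniqueness of paths in a tree, the parent of `c` is the penultimate node on the path from the
root to `c`. -/
theorem eq_of_mem_children {r a b c : ι} (ha : c ∈ D.children r a) (hb : c ∈ D.children r b) :
    a = b := by
  obtain ⟨q, hq, hq'⟩ := D.isTree.connected.exists_path_of_dist r c
  have key : ∀ {a}, c ∈ D.children r a → q.penultimate = a := by
    intro a ha
    obtain ⟨p, hp, hp'⟩ := D.isTree.connected.exists_path_of_dist r a
    have hlt := ha.2
    rw [← hp', ← hq'] at hlt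
    by_cases hc : c ∈ p.support
    · rw [D.isTree.isAcyclic.path_concat hq hp ha.1.symm hc, q.length_concat] at hlt
      omega
    · have hv := D.isTree.isAcyclic.mem_support_of_ne_mem_support_of_adj_of_isPath hq hp
        ha.1.symm hc
      rw [D.isTree.isAcyclic.path_concat hp hq ha.1 hv, SimpleGraph.Walk.penultimate_concat]
  rw [← key ha, ← key hb]

theorem dist_of_mem_children {r a c : ι} (h : c ∈ D.children r a) :
    D.tree.dist r c = D.tree.dist r a + 1 := by
  have := D.isTree.dist_eq_dist_add_one_of_adj r h.1
  have := h.2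
  omega

theorem exists_mem_children {r t : ι} (h : t ≠ r) : ∃ p, t ∈ D.children r p := by
  obtain ⟨q, hq⟩ := D.isTree.connected.exists_walk_length_eq_dist t r
  cases q with
  | nil => exact absurd rfl h
  | @cons _ p _ hadj q =>
    refine ⟨p, hadj.symm, ?_⟩
    have := D.tree.dist_le q
    rw [SimpleGraph.Walk.length_cons] at hq
    rw [D.tree.dist_comm, D.tree.dist_comm (u := r) (v := t)]
    omega

theorem eq_univ_of_children_mem {r : ι} {S : Set ι} (hr : r ∈ S)
    (h : ∀ t ∈ S, ∀ c ∈ D.children r t, c ∈ S) (t : ι) : t ∈ S := by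
  induction hd : D.tree.dist r t generalizing t with
  | zero =>
    rw [D.isTree.connected.dist_eq_zero_iff] at hd
    exact hd ▸ hr
  | succ d ih =>
    have hne : t ≠ r := by
      rintro rfl
      simp at hd
    obtain ⟨p, hp⟩ := D.exists_mem_children hne
    have := D.dist_of_mem_children hp
    exact h p (ih p (by omega)) t hp

/-- A path that leaves a node without using its parent must go to a child, and from there it cannot
turn back, so it only moves away from the root. -/
theorem dist_le_of_isPath {r a b : ι} (p : D.tree.Walk a b) (hp : p.IsPath) :
    ∀ c, a ∈ D.children r c → c ∉ p.support → D.tree.dist r a ≤ D.tree.dist r b := by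
  induction p with
  | nil => exact fun _ _ _ => le_rfl
  | @cons a x b hadj p ih =>
    intro c hc hcp
    rw [SimpleGraph.Walk.cons_isPath_iff] at hp
    rw [SimpleGraph.Walk.support_cons, List.mem_cons, not_or] at hcp
    rcases D.isTree.dist_eq_dist_add_one_of_adj r hadj with h | h
    · have hx : a ∈ D.children r x := ⟨hadj.symm, by omega⟩
      rw [D.eq_of_mem_children hc hx] at hcp
      exact absurd p.start_mem_support hcp.2
    · have := ih hp.1 a ⟨hadj, by omega⟩ hp.2
      omega

/-- The path from `t` to `s` must start with the parent of `t`: through a child it would only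
descend and end farther from the root than `t`. The parent lies on the path, so its bag contains
`v`. -/
theorem mem_bag_of_mem_children {r p t s : ι} {v : V} (hp : t ∈ D.children r p) (hts : t ≠ s)
    (hd : D.tree.dist r s ≤ D.tree.dist r t) (ht : v ∈ D.bag t) (hs : v ∈ D.bag s) :
    v ∈ D.bag p := by
  obtain ⟨q, hq, -⟩ := D.isTree.connected.exists_path_of_dist t s
  have hmem := D.path_mem t s q hq
  cases q with
  | nil => exact absurd rfl hts
  | @cons _ x _ hadj q =>
    have hx := hmem x (by simp) v ht hs
    rw [SimpleGraph.Walk.cons_isPath_iff] at hq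
    rcases D.isTree.dist_eq_dist_add_one_of_adj r hadj with h | h
    · rwa [D.eq_of_mem_children hp (show t ∈ D.children r x from ⟨hadj.symm, by omega⟩)]
    · have := D.dist_le_of_isPath (r := r) q hq.1 t ⟨hadj, by omega⟩ hq.2
      omega

/-- If every assignment that is good at a node can be modified, outside of the bag of this node, to
an assignment that is good at a given child, then an assignment that is good at the root yields one
that is good everywhere. -/
theorem exists_forall_good [Finite ι] {A : Type*} (r : ι) (Good : ι → (V → A) → Prop)
    (hcongr : ∀ t g g', (∀ v ∈ D.bag t, g' v = g v) → Good t g → Good t g')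
    (hext : ∀ t, ∀ c ∈ D.children r t, ∀ g, Good t g →
      ∃ g', Good c g' ∧ ∀ v ∈ D.bag t, v ∈ D.bag c → g' v = g v)
    (g : V → A) (hg : Good r g) : ∃ g, ∀ t, Good t g := by
  -- The assignment is made good level by level, by depth below the root.
  have key : ∀ d, ∃ g, ∀ t, D.tree.dist r t ≤ d → Good t g := by
    intro d
    induction d with
    | zero =>
      refine ⟨g, fun t ht => ?_⟩
      obtain rfl : r = t := D.isTree.connected.dist_eq_zero_iff.1 (by omega)
      exact hg
    | succ d ih =>
      obtain ⟨g, hg⟩ := ih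
      have hpar : ∀ t, D.tree.dist r t = d + 1 → ∃ p, t ∈ D.children r p ∧ D.tree.dist r p = d := by
        intro t ht
        obtain ⟨p, hp⟩ := D.exists_mem_children (r := r) (t := t) (by rintro rfl; simp at ht)
        exact ⟨p, hp, by have := D.dist_of_mem_children hp; omega⟩
      -- A vertex of `t` that also occurs at another node of depth at most `d + 1` lies in the
      -- parent's bag, so the modification at `t` leaves it alone.
      have hch : ∀ t, D.tree.dist r t = d + 1 → ∃ g', Good t g' ∧
          ∀ s, s ≠ t → D.tree.dist r s ≤ d + 1 → ∀ v ∈ D.bag t, v ∈ D.bag s → g' v = g v := by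
        intro t ht
        obtain ⟨p, hp, hpd⟩ := hpar t ht
        obtain ⟨g', hg', hgg⟩ := hext p t hp g (hg p hpd.le)
        exact ⟨g', hg', fun s hs hsd v hv hv' => hgg v
          (D.mem_bag_of_mem_children hp hs.symm (by omega) hv hv') hv⟩
      have : Nonempty (V → A) := ⟨g⟩
      choose! G hG hGg using hch
      classical
      -- All nodes of the new level are treated at once. The choice of the node for `v` is
      -- immaterial: if two of them contain `v`, both modifications keep the old value.
      refine ⟨fun v => if h : ∃ t, D.tree.dist r t = d + 1 ∧ v ∈ D.bag t
        then G h.choose v else g v, fun s hs => ?_⟩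
      rcases Nat.le_succ_iff.1 hs with hs' | hs'
      · refine hcongr s g _ (fun v hv => ?_) (hg s hs')
        split_ifs with h
        · exact hGg _ h.choose_spec.1 s (by intro he; have := h.choose_spec.1; rw [← he] at this; omega)
            hs v h.choose_spec.2 hv
        · rfl
      · refine hcongr s (G s) _ (fun v hv => ?_) (hG s hs')
        have h : ∃ t, D.tree.dist r t = d + 1 ∧ v ∈ D.bag t := ⟨s, hs', hv⟩
        rw [dif_pos h]
        by_cases he : h.choose = s
        · rw [he]
        · rw [hGg _ h.choose_spec.1 s (Ne.symm he) hs v h.choose_spec.2 hv,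
            hGg s hs' h.choose he h.choose_spec.1.le v hv h.choose_spec.2]
  obtain ⟨B, hB⟩ := (Set.finite_range (D.tree.dist r)).bddAbove
  obtain ⟨g, hg⟩ := key B
  exact ⟨g, fun t => hg t (hB ⟨t, rfl⟩)⟩

end TreeDecomposition

/-! ### Extending functions to larger finite sets -/

theorem Finset.exists_extension {V A : Type*} [DecidableEq V] (P : Finset V → (V → A) → Prop)
    (I X : Finset V) (hI : I ⊆ X)
    (hP : ∀ J ⊆ X, ∀ v ∈ X, v ∉ J → ∀ g, P J g → ∃ a, P (insert v J) (Function.update g v a))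
    (g : V → A) (hg : P I g) : ∃ g', P X g' ∧ ∀ v ∈ I, g' v = g v := by
  have key : ∀ d J, I ⊆ J → J ⊆ X → (X \ J).card = d → ∀ g', P J g' → (∀ v ∈ I, g' v = g v) →
      ∃ g', P X g' ∧ ∀ v ∈ I, g' v = g v := by
    intro d
    induction d with
    | zero =>
      intro J hIJ hJ hd g' hg' hgg
      rw [Finset.card_eq_zero, Finset.sdiff_eq_empty_iff_subset] at hd
      obtain rfl := hJ.antisymm hd
      exact ⟨g', hg', hgg⟩
    | succ d ih =>
      intro J hIJ hJ hd g' hg' hgg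
      obtain ⟨v, hv⟩ : (X \ J).Nonempty := by rw [← Finset.card_pos]; omega
      rw [Finset.mem_sdiff] at hv
      obtain ⟨a, ha⟩ := hP J hJ v hv.1 hv.2 g' hg'
      refine ih (insert v J) (hIJ.trans (Finset.subset_insert v J))
        (Finset.insert_subset hv.1 hJ) ?_ _ ha fun u hu => ?_
      · rw [Finset.sdiff_insert, Finset.card_erase_of_mem (Finset.mem_sdiff.2 hv), hd]
        rfl
      · rw [Function.update_of_ne (by rintro rfl; exact hv.2 (hIJ hu)), hgg u hu]
  exact key _ I subset_rfl hI rfl g hg fun _ _ => rfl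

/-- Pigeonhole, one vertex at a time: before the last vertex of `X` is reached, fewer than `k`
colors are in use. -/
theorem exists_injOn_extension {V : Type*} [DecidableEq V] {I X : Finset V} (hI : I ⊆ X) {k : ℕ}
    (hX : X.card ≤ k) (g : V → ℕ) (hg : Set.InjOn g I) (hgk : ∀ v ∈ I, g v < k) :
    ∃ g' : V → ℕ, (Set.InjOn g' X ∧ ∀ v ∈ X, g' v < k) ∧ ∀ v ∈ I, g' v = g v := by
  refine Finset.exists_extension (fun J g => Set.InjOn g J ∧ ∀ v ∈ J, g v < k) I X hI ?_ g ⟨hg, hgk⟩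
  rintro J hJ v hv hvJ g ⟨hg, hgk⟩
  obtain ⟨a, ha, ha'⟩ : ∃ a ∈ Finset.range k, a ∉ J.image g := by
    apply Finset.exists_mem_notMem_of_card_lt_card
    have h₁ := Finset.card_image_le (s := J) (f := g)
    have h₂ := Finset.card_lt_card (Finset.ssubset_iff_of_subset hJ |>.2 ⟨v, hv, hvJ⟩)
    simp only [Finset.card_range]
    omega
  refine ⟨a, ?_, ?_⟩
  · rw [Finset.coe_insert, Set.injOn_insert (by simpa using hvJ)]
    refine ⟨?_, ?_⟩
    · intro x hx y hy hxy
      have hx' : x ≠ v := by rintro rfl; exact hvJ hx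
      have hy' : y ≠ v := by rintro rfl; exact hvJ hy
      rw [Function.update_of_ne hx', Function.update_of_ne hy'] at hxy
      exact hg hx hy hxy
    · rintro ⟨x, hx, hxa⟩
      have hx' : x ≠ v := by rintro rfl; exact hvJ hx
      rw [Function.update_of_ne hx', Function.update_self] at hxa
      exact ha' (Finset.mem_image.2 ⟨x, hx, hxa⟩)
  · intro x hx
    by_cases hxv : x = v
    · rw [hxv, Function.update_self]
      exact Finset.mem_range.1 ha
    · rw [Function.update_of_ne hxv]
      exact hgk x ((Finset.mem_insert.1 hx).resolve_left hxv)

/-- The order `ℚ` is dense without endpoints, so a new vertex fits into any gap of the values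
already fixed. This is why glued ranks are rational although the ranks in the states are small
natural numbers. -/
theorem exists_order_extension {V : Type*} [DecidableEq V] {I X : Finset V} (hI : I ⊆ X)
    (r : V → ℕ) (g : V → ℚ) (hg : ∀ u ∈ I, ∀ v ∈ I, g u < g v ↔ r u < r v) :
    ∃ g' : V → ℚ, (∀ u ∈ X, ∀ v ∈ X, g' u < g' v ↔ r u < r v) ∧ ∀ v ∈ I, g' v = g v := by
  refine Finset.exists_extension (fun J g => ∀ u ∈ J, ∀ v ∈ J, g u < g v ↔ r u < r v) I X hI
    ?_ g hg
  intro J hJ v hv hvJ g hg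
  have hne : ∀ u ∈ J, u ≠ v := by rintro u hu rfl; exact hvJ hu
  suffices h : ∃ a, ∀ u ∈ J, (g u < a ↔ r u < r v) ∧ (a < g u ↔ r v < r u) by
    obtain ⟨a, ha⟩ := h
    refine ⟨a, fun x hx y hy => ?_⟩
    rcases Finset.mem_insert.1 hx with hxv | hx <;> rcases Finset.mem_insert.1 hy with hyv | hy
    · simp [hxv, hyv]
    · rw [hxv, Function.update_self, Function.update_of_ne (hne y hy)]
      exact (ha y hy).2
    · rw [hyv, Function.update_self, Function.update_of_ne (hne x hx)]
      exact (ha x hx).1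
    · rw [Function.update_of_ne (hne y hy), Function.update_of_ne (hne x hx)]
      exact hg x hx y hy
  -- Strict comparisons in both directions determine ties as well, so a vertex tied with an old one
  -- must receive its value.
  by_cases h : ∃ w ∈ J, r w = r v
  · obtain ⟨w, hw, hwv⟩ := h
    exact ⟨g w, fun u hu => by rw [hg u hu w hw, hg w hw u hu, hwv]; simp⟩
  · push Not at h
    obtain ⟨a, ha, ha'⟩ := Order.exists_between_finsets ((J.filter fun u => r u < r v).image g)
      ((J.filter fun u => r v < r u).image g) (by
        intro x hx y hy
        simp only [Finset.mem_image, Finset.mem_filter] at hx hy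
        obtain ⟨x, ⟨hx, hx'⟩, rfl⟩ := hx
        obtain ⟨y, ⟨hy, hy'⟩, rfl⟩ := hy
        exact (hg x hx y hy).2 (hx'.trans hy'))
    have ha₁ : ∀ u ∈ J, r u < r v → g u < a := fun u hu h' =>
      ha _ (Finset.mem_image.2 ⟨u, Finset.mem_filter.2 ⟨hu, h'⟩, rfl⟩)
    have ha₂ : ∀ u ∈ J, r v < r u → a < g u := fun u hu h' =>
      ha' _ (Finset.mem_image.2 ⟨u, Finset.mem_filter.2 ⟨hu, h'⟩, rfl⟩)
    refine ⟨a, fun u hu => ?_⟩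
    rcases lt_or_gt_of_ne (h u hu) with h' | h'
    · have := ha₁ u hu h'
      exact ⟨iff_of_true this h', iff_of_false this.not_gt h'.not_gt⟩
    · have := ha₂ u hu h'
      exact ⟨iff_of_false this.not_gt h'.not_gt, iff_of_true this h'⟩

/-! ### Colorings and tree decompositions -/

namespace Digraph

variable {V : Type*} {G : Digraph V}

/-- Along a directed walk inside a color class the rank strictly increases, so the walk cannot
close. -/
theorem acyclicColorable_of_rank {k : ℕ} {A : Type*} [Preorder A] (f : V → ℕ) (ρ : V → A)
    (hf : ∀ v, f v < k) (h : ∀ u v, G.Adj u v → f u = f v → ρ u < ρ v) :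
    G.AcyclicColorable k := by
  refine ⟨fun v => ⟨f v, hf v⟩, fun c v hv => lt_irrefl (ρ v) ?_⟩
  have key : ∀ a b, Relation.TransGen (fun a b => a ∈ {v | (⟨f v, hf v⟩ : Fin k) = c} ∧
      b ∈ {v | (⟨f v, hf v⟩ : Fin k) = c} ∧ G.Adj a b) a b → ρ a < ρ b := by
    have hstep : ∀ a b, (⟨f a, hf a⟩ : Fin k) = c → (⟨f b, hf b⟩ : Fin k) = c → G.Adj a b →
        ρ a < ρ b := by
      rintro a b ha hb hab
      rw [← hb, Fin.mk.injEq] at ha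
      exact h a b hab ha
    intro a b hab
    induction hab with
    | single h => exact hstep _ _ h.1 h.2.1 h.2.2
    | tail _ h ih => exact ih.trans (hstep _ _ h.1 h.2.1 h.2.2)
  exact key v v hv

/-- The rank of `v` is the number of vertices from which a nonempty monochromatic walk leads to `v`.
Along a monochromatic arc `uv` this set grows, and strictly so: it gains `u`, which by acyclicity
does not reach itself. -/
theorem AcyclicColorable.exists_rank [Finite V] {k : ℕ} (h : G.AcyclicColorable k) :
    ∃ (f : V → ℕ) (ρ : V → ℕ), (∀ v, f v < k) ∧ ∀ u v, G.Adj u v → f u = f v → ρ u < ρ v := by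
  obtain ⟨f, hf⟩ := h
  let R : V → V → Prop := fun a b => f a = f b ∧ G.Adj a b
  have key : ∀ a b, Relation.TransGen R a b → f a = f b ∧ Relation.TransGen
      (fun x y => x ∈ {v | f v = f b} ∧ y ∈ {v | f v = f b} ∧ G.Adj x y) a b := by
    intro a b hab
    induction hab with
    | single h => exact ⟨h.1, .single ⟨h.1, rfl, h.2⟩⟩
    | tail _ h ih =>
      rw [h.1] at ih
      exact ⟨ih.1, ih.2.tail ⟨h.1, rfl, h.2⟩⟩
  refine ⟨fun v => f v, fun v => {u | Relation.TransGen R u v}.ncard, fun v => (f v).2, ?_⟩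
  intro u v huv hf'
  have hR : R u v := ⟨Fin.ext hf', huv⟩
  refine Set.ncard_lt_ncard ⟨fun w hw => Relation.TransGen.tail hw hR, fun hsub => ?_⟩
    (Set.toFinite _)
  exact hf _ u (key u u (hsub (Relation.TransGen.single hR))).2

theorem exists_mem_bag_of_adj {ι : Type*} (D : TreeDecomposition G.toSimpleGraphInclusive ι)
    (hG : ∀ v, ¬ G.Adj v v) {u v : V} (h : G.Adj u v) : ∃ t, u ∈ D.bag t ∧ v ∈ D.bag t := by
  refine D.edge_mem u v ?_
  have : u ≠ v := by rintro rfl; exact hG u h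
  simp [Digraph.toSimpleGraphInclusive, this, h]

/-- A coloring that is injective on every bag is proper, since adjacent vertices share a bag; then
there are no monochromatic arcs, and a constant rank will do. -/
theorem acyclicColorable_of_card_bag_le {ι : Type*} [Finite ι]
    (D : TreeDecomposition G.toSimpleGraphInclusive ι) (hG : ∀ v, ¬ G.Adj v v) {k : ℕ}
    (hk : ∀ t, (D.bag t).card ≤ k) : G.AcyclicColorable k := by
  classical
  obtain ⟨r⟩ := D.isTree.connected.nonempty
  obtain ⟨g₀, hg₀, -⟩ := exists_injOn_extension (Finset.empty_subset (D.bag r)) (hk r)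
    (fun _ => 0) (by simp) (by simp)
  obtain ⟨g, hg⟩ := D.exists_forall_good r
    (fun t g => Set.InjOn g (D.bag t) ∧ ∀ v ∈ D.bag t, g v < k) (by
      intro t g g' hgg hg
      exact ⟨hg.1.congr fun v hv => (hgg v hv).symm, fun v hv => hgg v hv ▸ hg.2 v hv⟩) (by
      intro t c hc g hg
      obtain ⟨g', hg', hgg⟩ := exists_injOn_extension
        (Finset.inter_subset_right (s₁ := D.bag t) (s₂ := D.bag c)) (hk c) g
        (hg.1.mono (by simp)) fun v hv => hg.2 v (Finset.mem_inter.1 hv).1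
      exact ⟨g', hg', fun v hv hv' => hgg v (Finset.mem_inter.2 ⟨hv, hv'⟩)⟩) g₀ hg₀
  refine acyclicColorable_of_rank g (fun _ => 0) (fun v => ?_) fun u v huv hc => ?_
  · obtain ⟨t, ht⟩ := D.vertex_mem v
    exact (hg t).2 v ht
  · obtain ⟨t, hu, hv⟩ := exists_mem_bag_of_adj D hG huv
    exact absurd huv ((hg t).1 hu hv hc ▸ hG u)

end Digraph

/-! ### The dynamic program -/

/-- The data of the dynamic program: lists of the elements of the bags, and a finite set of states,
which assign colors and ranks to the positions in the list of a bag. -/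
structure Scheme (V ι : Type*) where
  len : ι → ℕ
  vert : ι → ℕ → V
  numStates : ℕ
  col : ℕ → ℕ → ℕ
  rank : ℕ → ℕ → ℕ

namespace Scheme

variable {V ι : Type*} (M : Scheme V ι)

/-- The colors of the state `σ` are below `k`, and the arcs inside the bag of `t` between vertices
of the same color go from smaller to larger ranks. -/
def Valid (G : Digraph V) (k : ℕ) (t : ι) (σ : ℕ) : Prop :=
  ∀ i < M.len t, M.col σ i < k ∧ ∀ j < M.len t, G.Adj (M.vert t i) (M.vert t j) →
    M.col σ i = M.col σ j → M.rank σ i < M.rank σ j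

/-- The states `σ` at `t` and `σ'` at `c` give the same colors to the common vertices of the bags
and order them in the same way. -/
def Compat (t : ι) (σ : ℕ) (c : ι) (σ' : ℕ) : Prop :=
  ∀ i < M.len t, ∀ i' < M.len c, M.vert t i = M.vert c i' → M.col σ i = M.col σ' i' ∧
    ∀ j < M.len t, ∀ j' < M.len c, M.vert t j = M.vert c j' →
      (M.rank σ i < M.rank σ j ↔ M.rank σ' i' < M.rank σ' j')

/-- The state `σ` at `t` extends to compatible valid states at all descendants of `t`. -/
inductive Feasible (G : Digraph V) (k : ℕ) (children : ι → Set ι) : ι → ℕ → Prop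
  | intro (t : ι) (σ : ℕ) (f : ι → ℕ) (hσ : M.Valid G k t σ)
      (hf : ∀ c ∈ children t, f c < M.numStates)
      (hfeas : ∀ c ∈ children t, Feasible G k children c (f c))
      (hcompat : ∀ c ∈ children t, M.Compat t σ c (f c)) : Feasible G k children t σ

variable {M}

/-- The recursion that the algorithm evaluates; the choice function in the constructor becomes a
separate existential for each child. -/
theorem feasible_iff {G : Digraph V} {k : ℕ} {children : ι → Set ι} {t : ι} {σ : ℕ} :
    M.Feasible G k children t σ ↔ M.Valid G k t σ ∧ ∀ c ∈ children t,
      ∃ σ' < M.numStates, M.Feasible G k children c σ' ∧ M.Compat t σ c σ' := by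
  constructor
  · rintro ⟨_, _, f, h₁, h₂, h₃, h₄⟩
    exact ⟨h₁, fun c hc => ⟨f c, h₂ c hc, h₃ c hc, h₄ c hc⟩⟩
  · rintro ⟨h₁, h₂⟩
    choose! f hf using h₂
    exact ⟨t, σ, f, h₁, fun c hc => (hf c hc).1, fun c hc => (hf c hc).2.1,
      fun c hc => (hf c hc).2.2⟩

/-- The lists of a scheme list the bags of a tree decomposition with bags of size at most `m`, and
all assignments of colors and ranks below `m` are among the states. -/
structure Represents (M : Scheme V ι) {G : SimpleGraph V} (D : TreeDecomposition G ι) (m : ℕ) :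
    Prop where
  mem_bag : ∀ t v, v ∈ D.bag t ↔ ∃ i < M.len t, M.vert t i = v
  vert_inj : ∀ t, ∀ i < M.len t, ∀ j < M.len t, M.vert t i = M.vert t j → i = j
  len_le : ∀ t, M.len t ≤ m
  exists_state : ∀ d e : ℕ → ℕ, (∀ i < m, d i < m) → (∀ i < m, e i < m) →
    ∃ σ < M.numStates, ∀ i < m, M.col σ i = d i ∧ M.rank σ i = e i

variable {G : Digraph V} {D : TreeDecomposition G.toSimpleGraphInclusive ι} {m k : ℕ}

theorem Represents.vert_mem {G : SimpleGraph V} {D : TreeDecomposition G ι}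
    (hM : M.Represents D m) {t : ι} {i : ℕ} (hi : i < M.len t) : M.vert t i ∈ D.bag t :=
  (hM.mem_bag t _).2 ⟨i, hi, rfl⟩

theorem Represents.card_bag_le {G : SimpleGraph V} {D : TreeDecomposition G ι}
    (hM : M.Represents D m) (t : ι) : (D.bag t).card ≤ m := by
  classical
  have : D.bag t ⊆ (Finset.range (M.len t)).image (M.vert t) := fun v hv => by
    obtain ⟨i, hi, rfl⟩ := (hM.mem_bag t v).1 hv
    exact Finset.mem_image_of_mem _ (Finset.mem_range.2 hi)
  have h := (Finset.card_le_card this).trans Finset.card_image_le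
  rw [Finset.card_range] at h
  exact h.trans (hM.len_le t)

theorem Represents.exists_pos {G : SimpleGraph V} {D : TreeDecomposition G ι}
    (hM : M.Represents D m) (t : ι) :
    ∃ pos : V → ℕ, ∀ i < M.len t, pos (M.vert t i) = i := by
  classical
  refine ⟨fun v => if h : ∃ i < M.len t, M.vert t i = v then h.choose else 0, fun i hi => ?_⟩
  have h : ∃ j < M.len t, M.vert t j = M.vert t i := ⟨i, hi, rfl⟩
  simp only [dif_pos h]
  exact hM.vert_inj t _ h.choose_spec.1 i hi h.choose_spec.2

theorem Represents.acyclicColorable [Finite ι] (hM : M.Represents D m) (hG : ∀ v, ¬ G.Adj v v)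
    {r : ι} {σ₀ : ℕ} (hfeas : M.Feasible G k (D.children r) r σ₀) :
    G.AcyclicColorable k := by
  classical
  -- The glued assignment takes the colors literally from the states but only realizes the order of
  -- their ranks.
  let Matches (t : ι) (σ : ℕ) (g : V → ℕ × ℚ) : Prop := ∀ i < M.len t,
    (g (M.vert t i)).1 = M.col σ i ∧ ∀ j < M.len t,
      ((g (M.vert t i)).2 < (g (M.vert t j)).2 ↔ M.rank σ i < M.rank σ j)
  obtain ⟨pos, hpos⟩ := hM.exists_pos r
  obtain ⟨g, hg⟩ := D.exists_forall_good r
    (fun t g => ∃ σ, M.Feasible G k (D.children r) t σ ∧ Matches t σ g) (by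
      rintro t g g' hgg ⟨σ, hσ, hm⟩
      refine ⟨σ, hσ, fun i hi => ?_⟩
      rw [hgg _ (hM.vert_mem hi)]
      refine ⟨(hm i hi).1, fun j hj => ?_⟩
      rw [hgg _ (hM.vert_mem hj)]
      exact (hm i hi).2 j hj) (by
      rintro t c hc g ⟨σ, hσ, hm⟩
      obtain ⟨σ', -, hσ', hcompat⟩ := (feasible_iff.1 hσ).2 c hc
      obtain ⟨pos, hpos⟩ := hM.exists_pos c
      -- Compatibility says that on the common vertices the values inherited from `t` are already
      -- ordered as the child's state demands.
      obtain ⟨g', hg', hgg⟩ := exists_order_extension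
        (Finset.inter_subset_right (s₁ := D.bag t) (s₂ := D.bag c))
        (fun v => M.rank σ' (pos v)) (fun v => (g v).2) (by
          intro u hu v hv
          rw [Finset.mem_inter, hM.mem_bag, hM.mem_bag] at hu hv
          obtain ⟨⟨i, hi, rfl⟩, i', hi', hii⟩ := hu
          obtain ⟨⟨j, hj, rfl⟩, j', hj', hjj⟩ := hv
          have h₁ := (hcompat i hi i' hi' hii.symm).2 j hj j' hj' hjj.symm
          rw [(hm i hi).2 j hj, h₁, ← hii, ← hjj, hpos _ hi', hpos _ hj'])
      refine ⟨fun v => (M.col σ' (pos v), g' v), ⟨σ', hσ', fun i hi => ⟨?_, fun j hj => ?_⟩⟩,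
        fun v hv hv' => ?_⟩
      · simp only [hpos i hi]
      · simp only [hg' _ (hM.vert_mem hi) _ (hM.vert_mem hj), hpos i hi, hpos j hj]
      · refine Prod.ext ?_ (hgg v (Finset.mem_inter.2 ⟨hv, hv'⟩))
        rw [hM.mem_bag] at hv hv'
        obtain ⟨i, hi, rfl⟩ := hv
        obtain ⟨i', hi', hii⟩ := hv'
        rw [(hm i hi).1, (hcompat i hi i' hi' hii.symm).1, ← hii]
        simp only [hpos i' hi'])
    (fun v => (M.col σ₀ (pos v), M.rank σ₀ (pos v)))
    ⟨σ₀, hfeas, fun i hi => ⟨by simp only [hpos i hi], fun j hj => by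
      simp only [hpos i hi, hpos j hj, Nat.cast_lt]⟩⟩
  refine Digraph.acyclicColorable_of_rank (fun v => (g v).1) (fun v => (g v).2) (fun v => ?_)
    fun u v huv hc => ?_
  · obtain ⟨t, ht⟩ := D.vertex_mem v
    obtain ⟨i, hi, rfl⟩ := (hM.mem_bag t v).1 ht
    obtain ⟨σ, hσ, hm⟩ := hg t
    simp only [(hm i hi).1]
    exact ((feasible_iff.1 hσ).1 i hi).1
  -- Every arc lies inside some bag, where validity of the state orders its ends.
  · obtain ⟨t, hu, hv⟩ := Digraph.exists_mem_bag_of_adj D hG huv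
    obtain ⟨i, hi, rfl⟩ := (hM.mem_bag t u).1 hu
    obtain ⟨j, hj, rfl⟩ := (hM.mem_bag t v).1 hv
    obtain ⟨σ, hσ, hm⟩ := hg t
    simp only [(hm i hi).1, (hm j hj).1] at hc
    exact ((hm i hi).2 j hj).2 (((feasible_iff.1 hσ).1 i hi).2 j hj huv hc)

/-- Only the order within each bag is recorded, so the global rank can be compressed to values below
the bag size, and these are among the states. -/
theorem Represents.exists_feasible [Finite V] [Finite ι] (hM : M.Represents D m) (hk : k ≤ m)
    (r : ι) (h : G.AcyclicColorable k) :
    ∃ σ < M.numStates, M.Feasible G k (D.children r) r σ := by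
  classical
  obtain ⟨f, ρ, hf, hρ⟩ := h.exists_rank
  -- The number of elements of the bag with smaller rank. It orders the bag as `ρ` does, and on the
  -- bag it stays below `m` because `v` does not count itself.
  let e (t : ι) (v : V) : ℕ := ((D.bag t).filter fun u => ρ u < ρ v).card
  have he : ∀ t, ∀ u ∈ D.bag t, ∀ v, e t u < e t v ↔ ρ u < ρ v := by
    intro t u hu v
    constructor
    · intro h
      by_contra! h'
      refine absurd (Finset.card_le_card ?_) (not_le.2 h)
      exact Finset.monotone_filter_right _ fun w _ hw => lt_of_lt_of_le hw h'
    · intro h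
      refine Finset.card_lt_card ((Finset.ssubset_iff_of_subset ?_).2 ⟨u, ?_, ?_⟩)
      · exact Finset.monotone_filter_right _ fun w _ hw => lt_trans hw h
      · simp [hu, h]
      · simp
  have hs : ∀ t, ∃ σ < M.numStates, ∀ i < M.len t,
      M.col σ i = f (M.vert t i) ∧ M.rank σ i = e t (M.vert t i) := by
    intro t
    obtain ⟨σ, hσ, hσ'⟩ := hM.exists_state
      (fun i => if i < M.len t then f (M.vert t i) else 0)
      (fun i => if i < M.len t then e t (M.vert t i) else 0) (by
        intro i hi
        split_ifs
        · exact (hf _).trans_le hk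
        · omega) (by
        intro i hi
        split_ifs with hi'
        · refine lt_of_lt_of_le (Finset.card_lt_card ?_) (hM.card_bag_le t)
          exact (Finset.ssubset_iff_of_subset (Finset.filter_subset _ _)).2
            ⟨_, hM.vert_mem hi', by simp⟩
        · omega)
    refine ⟨σ, hσ, fun i hi => ?_⟩
    have := hσ' i (hi.trans_le (hM.len_le t))
    rwa [if_pos hi, if_pos hi] at this
  choose st hst hcol using hs
  obtain ⟨B, hB⟩ := (Set.finite_range (D.tree.dist r)).bddAbove
  -- `B` bounds the depth of the tree, so `B - depth` decreases towards the children.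
  have key : ∀ d t, B - D.tree.dist r t = d → M.Feasible G k (D.children r) t (st t) := by
    intro d
    induction d using Nat.strong_induction_on with
    | _ d ih =>
      intro t ht
      refine ⟨t, st t, st, fun i hi => ⟨?_, fun j hj hadj hc => ?_⟩, fun c _ => hst c,
        fun c hc => ?_, fun c _ i hi i' hi' hii => ⟨?_, fun j hj j' hj' hjj => ?_⟩⟩
      · rw [(hcol t i hi).1]
        exact hf _
      · rw [(hcol t i hi).1, (hcol t j hj).1] at hc
        rw [(hcol t i hi).2, (hcol t j hj).2, he t _ (hM.vert_mem hi)]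
        exact hρ _ _ hadj hc
      · have h₁ := D.dist_of_mem_children hc
        have h₂ : D.tree.dist r c ≤ B := hB ⟨c, rfl⟩
        exact ih (B - D.tree.dist r c) (by omega) c rfl
      · rw [(hcol t i hi).1, (hcol c i' hi').1, hii]
      · rw [(hcol t i hi).2, (hcol t j hj).2, (hcol c i' hi').2, (hcol c j' hj').2,
          he t _ (hM.vert_mem hi), he c _ (hM.vert_mem hi'), hii, hjj]
  exact ⟨st r, hst r, key _ r rfl⟩

end Scheme

namespace RAM

/-! ### Preparatory programs -/

theorem Within.for_const {x : ℕ} {e : Expr} {P : Program} {s : State} {n K : ℕ}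
    (I : ℕ → State → Prop) (hx : x ∉ P.wregs)
    (he : ∀ s', Agree (.for x e P) s s' → e.eval s' = n) (h0 : I 0 (s.setReg x 0))
    (hstep : ∀ i < n, ∀ s', Agree (.for x e P) s s' → s'.reg x = i → I i s' →
      Within P s' K fun s'' => I (i + 1) (s''.setReg x (i + 1))) :
    Within (.for x e P) s (e.cost + 5 + n * (K + e.cost + 7)) (I n) := by
  have h := Within.for (K := fun _ => K) I hx he h0 hstep
  rwa [Finset.sum_const, Finset.card_range, smul_eq_mul] at h

/-- Fill an array with the multiples of the content of a register. -/
def mulTable (a cnt stp : ℕ) : Program :=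
  .seq (.assign 9 (.const 0)) (.for 8 (.reg cnt)
    (.seq (.write a (.reg 8) (.reg 9)) (.assign 9 (.add (.reg 9) (.reg stp)))))

theorem within_mulTable {a cnt stp : ℕ} (hc : cnt < 8) (hs : stp < 8) (s : State) :
    Within (mulTable a cnt stp) s (20 * (s.reg cnt + 1))
      fun s' => ∀ i < s.reg cnt, s'.arr a i = i * s.reg stp := by
  refine (Within.seq (.assign ((Within.for_const (n := s.reg cnt) (K := 7)
    (fun i s' => s'.reg 9 = i * s.reg stp ∧ ∀ j < i, s'.arr a j = j * s.reg stp)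
    ?_ ?_ ?_ ?_).mono le_rfl fun s' _ h => h.2))).mono ?_ fun _ _ h => h
  · simp [Program.wregs]
  · intro s' h
    rw [Expr.eval, h.1 cnt (by simp [Program.for, Program.wregs]; omega), State.setReg_reg,
      if_neg (by omega)]
  · simp [Expr.eval]
  · rintro i hi s' h hr ⟨h₁, h₂⟩
    have hstp : s'.reg stp = s.reg stp := by
      rw [h.1 stp (by simp [Program.for, Program.wregs]; omega), State.setReg_reg,
        if_neg (by omega)]
    refine Within.mono (.seq (.write (.assign ?_))) (by simp [Expr.cost]) fun _ _ h => h
    refine ⟨?_, fun j hj => ?_⟩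
    · simp [Expr.eval, h₁, hstp, Nat.add_mul]
    · simp only [Expr.eval, State.setReg_arr, State.setArr_arr, if_true, hr, h₁,
        Function.update_apply]
      split_ifs with hji
      · rw [hji]
      · exact h₂ j (by omega)
  · simp only [Expr.cost]
    omega

/-- Compute the largest size of a bag. -/
def maxLen : Program :=
  .seq (.assign 5 (.const 0)) (.for 8 (.reg 1)
    (.ite (.sub (.read 7 (.reg 8)) (.reg 5)) (.assign 5 (.read 7 (.reg 8))) .skip))

theorem within_maxLen (s : State) :
    Within maxLen s (20 * (s.reg 1 + 1))
      fun s' => s'.reg 5 = (Finset.range (s.reg 1)).sup (s.arr 7) := by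
  refine (Within.seq (.assign (Within.for_const (n := s.reg 1) (K := 8)
    (fun i s' => s'.reg 5 = (Finset.range i).sup (s.arr 7)) ?_ ?_ ?_ ?_))).mono ?_ fun _ _ h => h
  · decide
  · intro s' h
    rw [Expr.eval, h.1 1 (by decide)]
    simp
  · simp [Expr.eval]
  · intro i hi s' h hr h₁
    have h7 : s'.arr 7 = s.arr 7 := h.2 7 (by decide)
    rw [Finset.range_add_one, Finset.sup_insert]
    refine Within.mono (.ite (K := 3) (fun hlt => ?_) (fun hlt => ?_)) (by simp [Expr.cost])
      fun _ _ h => h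
    · refine .assign ?_
      simp only [Expr.eval, hr, h₁, h7] at hlt ⊢
      rw [State.setReg_reg, if_neg (by decide), State.setReg_reg, if_pos rfl, sup_eq_left.2 (by omega)]
    · refine Within.mono (.skip ?_) (by omega) fun _ _ h => h
      simp only [Expr.eval, hr, h₁, h7] at hlt
      rw [State.setReg_reg, if_neg (by decide), h₁, sup_eq_right.2 (by omega)]
  · simp only [Expr.cost]
    omega

/-- Mark the arcs of the digraph in an adjacency matrix. -/
def markArcs : Program :=
  .for 8 (.reg 4) (.for 9 (.read 1 (.reg 8))
    (.write 10 (.add (.read 9 (.reg 8)) (.read 2 (.add (.read 0 (.reg 8)) (.reg 9)))) (.const 1)))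

/-- Array `10` is zero from the start, so the absent arcs of the matrix cost nothing and the time is
linear in the number of vertices and arcs. -/
theorem within_markArcs (s : State) (h0 : ∀ p, s.arr 10 p = 0) :
    Within markArcs s (40 * (s.reg 4 + 1) + 40 * ∑ u ∈ Finset.range (s.reg 4), s.arr 1 u)
      fun s' => ∀ p, s'.arr 10 p ≠ 0 ↔ ∃ u < s.reg 4, ∃ j < s.arr 1 u,
        p = s.arr 9 u + s.arr 2 (s.arr 0 u + j) := by
  refine (Within.for (n := s.reg 4) (K := fun u => 7 + s.arr 1 u * 19)
    (fun i s' => ∀ p, s'.arr 10 p ≠ 0 ↔ ∃ u < i, ∃ j < s.arr 1 u,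
        p = s.arr 9 u + s.arr 2 (s.arr 0 u + j)) ?_ ?_ ?_ ?_).mono ?_ fun _ _ h => h
  · decide
  · intro s' h
    exact h.1 4 (by decide)
  · simp [h0]
  · intro i hi s' h hr h₁
    have ha : ∀ a, a ≠ 10 → s'.arr a = s.arr a := fun a ha =>
      h.2 a (by simpa [Program.for, Program.warrs] using ha)
    refine (Within.for_const (n := s.arr 1 i)
      (fun j s' => ∀ p, s'.arr 10 p ≠ 0 ↔ (∃ u < i, ∃ j < s.arr 1 u,
        p = s.arr 9 u + s.arr 2 (s.arr 0 u + j)) ∨ ∃ j' < j,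
          p = s.arr 9 i + s.arr 2 (s.arr 0 i + j')) ?_ ?_ ?_ ?_).mono
      (K := 7 + s.arr 1 i * (10 + 2 + 7)) (by omega) fun s'' _ h => ?_
    · decide
    · intro s'' h'
      rw [Expr.eval, Expr.eval, h'.1 8 (by decide), hr, h'.2 1 (by decide), ha 1 (by decide)]
    · simpa using h₁
    · intro j hj s'' h' hr' h₂
      have ha' : ∀ a, a ≠ 10 → s''.arr a = s.arr a := fun a h =>
        (h'.2 a (by simpa [Program.for, Program.warrs] using h)).trans (ha a h)
      have hr'' : s''.reg 8 = i := by rw [h'.1 8 (by decide), hr]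
      refine Within.mono (.write ?_) (by simp [Expr.cost]) fun _ _ h => h
      intro p
      simp only [Expr.eval, State.setReg_arr, State.setArr_arr, if_true, hr', hr'',
        Function.update_apply, ha' 9 (by decide), ha' 2 (by decide), ha' 0 (by decide)]
      split_ifs with hp
      · simp only [ne_eq, one_ne_zero, not_false_eq_true, true_iff]
        exact .inr ⟨j, by omega, hp⟩
      · rw [h₂ p]
        refine or_congr Iff.rfl ⟨?_, ?_⟩
        · rintro ⟨j', hj', h⟩
          exact ⟨j', by omega, h⟩
        · rintro ⟨j', hj', h⟩
          refine ⟨j', ?_, h⟩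
          rcases Nat.lt_succ_iff_lt_or_eq.1 hj' with h' | rfl
          · exact h'
          · exact absurd h hp
    · intro p
      simp only [State.setReg_arr]
      rw [h p]
      constructor
      · rintro (⟨u, hu, hj⟩ | hj)
        · exact ⟨u, by omega, hj⟩
        · exact ⟨i, by omega, hj⟩
      · rintro ⟨u, hu, hj⟩
        rcases Nat.lt_succ_iff_lt_or_eq.1 hu with h' | rfl
        · exact .inl ⟨u, h', hj⟩
        · exact .inr hj
  · simp only [Expr.cost, Finset.sum_add_distrib, Finset.sum_const, Finset.card_range,
      ← Finset.sum_mul, smul_eq_mul]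
    omega

/-- Compute the number of states. -/
def countStates : Program :=
  .seq (.assign 6 (.add (.reg 5) (.reg 5))) (.seq (.assign 7 (.const 1))
    (.for 8 (.reg 6) (.seq (.assign 10 (.const 0))
      (.seq (.for 9 (.reg 5) (.assign 10 (.add (.reg 10) (.reg 7)))) (.assign 7 (.reg 10))))))

/-- Each of the `2 * m` multiplications by `m` is carried out by `m` additions. -/
theorem within_countStates (s : State) :
    Within countStates s (20 + 2 * s.reg 5 * (20 + 20 * s.reg 5))
      fun s' => s'.reg 6 = 2 * s.reg 5 ∧ s'.reg 7 = s.reg 5 ^ (2 * s.reg 5) := by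
  refine Within.mono (.seq (.assign (.seq (.assign ((Within.for_const (n := 2 * s.reg 5)
    (K := 2 + (6 + s.reg 5 * 12 + 2))
    (fun i s' => s'.reg 7 = s.reg 5 ^ i) ?_ ?_ ?_ ?_).mono le_rfl
    (Q' := fun s' => s'.reg 6 = 2 * s.reg 5 ∧ s'.reg 7 = s.reg 5 ^ (2 * s.reg 5)) ?_)))))
      ?_ fun _ _ h => h
  · decide
  · intro s' h
    rw [Expr.eval, h.1 6 (by decide)]
    simp [Expr.eval]
    omega
  · simp [Expr.eval]
  · intro i hi s' h hr h₁
    have h5 : s'.reg 5 = s.reg 5 := by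
      rw [h.1 5 (by decide)]
      simp
    refine .seq (.assign (.seq ((Within.for_const (n := s.reg 5) (K := 4)
      (fun j s' => s'.reg 10 = j * s.reg 5 ^ i ∧ s'.reg 7 = s.reg 5 ^ i) ?_ ?_ ?_ ?_).mono le_rfl
      fun s'' _ h => Within.assign ?_)))
    · decide
    · intro s'' h'
      rw [Expr.eval, h'.1 5 (by decide)]
      simp [h5]
    · simp [Expr.eval, h₁]
    · rintro j hj s'' h' hr' ⟨h₂, h₃⟩
      refine .assign ?_
      simp [Expr.eval, h₂, h₃, Nat.add_mul]
    · simp [Expr.eval, h.1, pow_succ, mul_comm]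
  · rintro s' h h'
    refine ⟨?_, h'⟩
    rw [h.1 6 (by decide)]
    simp [Expr.eval]
    omega
  · simp only [Expr.cost]
    have : 2 * s.reg 5 * (2 + (6 + s.reg 5 * 12 + 2) + 1 + 7) ≤
      2 * s.reg 5 * (20 + 20 * s.reg 5) := Nat.mul_le_mul_left _ (by omega)
    omega

/-- Compute the digits of the states. -/
def digitTable : Program :=
  .seq (.assign 10 (.const 0)) (.seq (.assign 11 (.const 0))
    (.for 8 (.reg 7) (.seq (.write 12 (.read 11 (.reg 8)) (.reg 11))
      (.seq (.for 9 (.sub (.reg 6) (.const 1))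
        (.write 12 (.add (.add (.read 11 (.reg 8)) (.reg 9)) (.const 1))
          (.read 12 (.add (.read 11 (.reg 10)) (.reg 9)))))
        (.seq (.assign 11 (.add (.reg 11) (.const 1)))
          (.ite (.sub (.reg 5) (.reg 11)) .skip
            (.seq (.assign 11 (.const 0)) (.assign 10 (.add (.reg 10) (.const 1))))))))))

theorem mul_add_inj {a b c d n : ℕ} (hb : b < n) (hd : d < n) :
    a * n + b = c * n + d ↔ a = c ∧ b = d := by
  constructor
  · intro h
    have h₁ := congrArg (· / n) h
    have h₂ := congrArg (· % n) h
    have hn : 0 < n := by omega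
    simp only [Nat.mul_comm _ n, Nat.mul_add_mod, Nat.mod_eq_of_lt hb, Nat.mod_eq_of_lt hd,
      Nat.mul_add_div hn, Nat.div_eq_of_lt hb, Nat.div_eq_of_lt hd, Nat.add_zero] at h₁ h₂
    exact ⟨h₁, h₂⟩
  · rintro ⟨rfl, rfl⟩
    rfl

/-- The lowest digit of `i` is `i % m`, and its digit `j + 1` is the digit `j` of `i / m`, which
stands in the table already. Registers `10` and `11` follow `i / m` and `i % m` like an odometer, so
no division is needed. -/
theorem within_digitTable (s : State) (hm : 1 ≤ s.reg 5) (hL : 1 ≤ s.reg 6)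
    (h11 : ∀ σ < s.reg 7, s.arr 11 σ = σ * s.reg 6) :
    Within digitTable s (20 + s.reg 7 * (60 + 60 * s.reg 6))
      fun s' => ∀ σ < s.reg 7, ∀ i < s.reg 6,
        s'.arr 12 (σ * s.reg 6 + i) = σ / s.reg 5 ^ i % s.reg 5 := by
  set m := s.reg 5
  set L := s.reg 6
  refine Within.mono (.seq (.assign (.seq (.assign ((Within.for_const (n := s.reg 7)
    (K := 4 + (8 + (L - 1) * 22 + (4 + (3 + 1 + 6))))
    (fun i s' => s'.reg 10 = i / m ∧ s'.reg 11 = i % m ∧ ∀ σ < i, ∀ j < L,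
      s'.arr 12 (σ * L + j) = σ / m ^ j % m) ?_ ?_ ?_ ?_).mono le_rfl
      fun _ _ h => h.2.2)))))
      ?_ fun _ _ h => h
  · decide
  · intro s' h
    rw [Expr.eval, h.1 7 (by decide)]
    simp
  · simp [Expr.eval]
  · rintro i hi s' h hr ⟨h₁, h₂, h₃⟩
    have h5 : s'.reg 5 = m := by rw [h.1 5 (by decide)]; simp [m]
    have h6 : s'.reg 6 = L := by rw [h.1 6 (by decide)]; simp [L]
    have hmul : ∀ σ ≤ i, s'.arr 11 σ = σ * L := fun σ hσ => by
      rw [h.2 11 (by decide)]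
      exact h11 σ (by omega)
    have hdiv : i / m ≤ i := Nat.div_le_self i m
    -- The row `i / m` may be the row `i` itself, for instance when `i = 0`. The invariant therefore
    -- includes the part of row `i` already written, and copying digit `j` to place `j + 1` still
    -- reads a finished cell.
    refine .seq (.write (.seq (Within.mono (Within.for_const (n := L - 1) (K := 12)
      (fun j s' => ∀ σ ≤ i, ∀ j' < L, (σ < i ∨ j' ≤ j) →
        s'.arr 12 (σ * L + j') = σ / m ^ j' % m) ?_ ?_ ?_ ?_) ?_
        fun s'' hs'' h'' => .seq (.assign (.ite ?_ ?_)))))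
    · decide
    · intro s'' h'
      simp only [Expr.eval, h'.1 6 (by decide)]
      simp [h6]
    · intro σ hσ j' hj' hor
      simp only [Expr.eval, State.setReg_arr, State.setArr_arr, if_true, hr, hmul i le_rfl, h₂,
        Function.update_apply]
      split_ifs with he
      · rw [← Nat.add_zero (i * L), mul_add_inj hj' (by omega)] at he
        rw [he.1, he.2, pow_zero, Nat.div_one]
      · refine h₃ σ ?_ j' hj'
        rcases hor with h | h
        · exact h
        · refine lt_of_le_of_ne hσ ?_
          rintro rfl
          exact he (by omega)
    · intro j hj s'' h' hr' h₄
      have h8 : s''.reg 8 = i := by rw [h'.1 8 (by decide)]; simp [hr]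
      have h10 : s''.reg 10 = i / m := by rw [h'.1 10 (by decide)]; simp [h₁]
      have hmul' : ∀ σ ≤ i, s''.arr 11 σ = σ * L := fun σ hσ => by
        rw [h'.2 11 (by decide)]
        simp [hmul σ hσ]
      refine Within.mono (.write ?_) (by simp [Expr.cost]) fun _ _ h => h
      intro σ hσ j' hj' hor
      simp only [Expr.eval, State.setReg_arr, State.setArr_arr, if_true, hr', h8, h10,
        hmul' i le_rfl, hmul' _ hdiv, Function.update_apply]
      split_ifs with he
      · rw [Nat.add_assoc, mul_add_inj hj' (by omega)] at he
        rw [h₄ _ hdiv j (by omega) (.inr le_rfl), he.1, he.2, pow_succ', Nat.div_div_eq_div_mul]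
      · refine h₄ σ hσ j' hj' ?_
        rcases hor with h | h
        · exact .inl h
        · by_contra hcon
          push Not at hcon
          obtain rfl : σ = i := by omega
          exact he (by omega)
    · simp [Expr.cost]
    · intro hlt
      refine Within.mono (K := 1) (.skip ?_) (by omega) fun _ _ h => h
      have h11' : s''.reg 11 = i % m := by rw [hs''.1 11 (by decide)]; simp [h₂]
      have h10 : s''.reg 10 = i / m := by rw [hs''.1 10 (by decide)]; simp [h₁]
      have h5' : s''.reg 5 = m := by rw [hs''.1 5 (by decide)]; simp [h5]
      simp only [Expr.eval, State.setReg_reg, h11', h5'] at hlt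
      have hlt' : i % m + 1 < m := by
        simp at hlt
        omega
      have := (Nat.div_mod_unique (a := i + 1) (b := m) (c := i % m + 1) (d := i / m) hm).2
        ⟨by have := Nat.mod_add_div i m; omega, hlt'⟩
      refine ⟨?_, ?_, fun σ hσ j hj => ?_⟩
      · simp [Expr.eval, h10, this.1]
      · simp [Expr.eval, h11', this.2]
      · simp only [State.setReg_arr]
        exact h'' σ (by omega) j hj (.inr (by omega))
    · intro hge
      refine Within.mono (K := 6) (.seq (.assign (.assign ?_))) (by decide)
        fun _ _ h => h
      have h11' : s''.reg 11 = i % m := by rw [hs''.1 11 (by decide)]; simp [h₂]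
      have h10 : s''.reg 10 = i / m := by rw [hs''.1 10 (by decide)]; simp [h₁]
      have h5' : s''.reg 5 = m := by rw [hs''.1 5 (by decide)]; simp [h5]
      simp only [Expr.eval, State.setReg_reg, h11', h5'] at hge
      have hge' : i % m + 1 = m := by
        have := Nat.mod_lt i hm
        simp at hge
        omega
      have := (Nat.div_mod_unique (a := i + 1) (b := m) (c := 0) (d := i / m + 1) hm).2
        ⟨by have := Nat.mod_add_div i m; rw [Nat.mul_add]; omega, hm⟩
      refine ⟨?_, ?_, fun σ hσ j hj => ?_⟩
      · simp [Expr.eval, h10, this.1]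
      · simp [Expr.eval, this.2]
      · simp only [State.setReg_arr]
        exact h'' σ (by omega) j hj (.inr (by omega))
  · simp only [Expr.cost]
    have : s.reg 7 * (4 + (8 + (L - 1) * 22 + (4 + (3 + 1 + 6))) + 1 + 7) ≤
      s.reg 7 * (60 + 60 * L) := Nat.mul_le_mul_left _ (by omega)
    omega

/-- Induction that splits off the lowest digit `d 0`. -/
theorem exists_digits {m : ℕ} (L : ℕ) (d : ℕ → ℕ) (hd : ∀ i < L, d i < m) :
    ∃ σ < m ^ L, ∀ i < L, σ / m ^ i % m = d i := by
  induction L generalizing d with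
  | zero => exact ⟨0, by simp, by simp⟩
  | succ L ih =>
    obtain ⟨σ, hσ, h⟩ := ih (fun i => d (i + 1)) fun i hi => hd (i + 1) (by omega)
    have h0 := hd 0 (by omega)
    refine ⟨d 0 + m * σ, ?_, fun i hi => ?_⟩
    · have : m * (σ + 1) ≤ m * m ^ L := Nat.mul_le_mul_left m hσ
      rw [pow_succ']
      rw [Nat.mul_add] at this
      omega
    · cases i with
      | zero => rw [pow_zero, Nat.div_one, Nat.add_mul_mod_self_left, Nat.mod_eq_of_lt h0]
      | succ i =>
        rw [pow_succ', ← Nat.div_div_eq_div_mul, Nat.add_mul_div_left _ _ (by omega),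
          Nat.div_eq_of_lt h0, Nat.zero_add]
        exact h i (by omega)

end RAM

/-! ### Listing the nodes of a rooted tree -/

/-- The list `l` starts with the root and continues with the children of its first `h` members, and
parents precede their children. -/
structure TreeDecomposition.QueueOf {V ι : Type*} {G : SimpleGraph V} (D : TreeDecomposition G ι)
    (r : ι) (l : List ι) (h : ℕ) : Prop where
  nodup : l.Nodup
  head : l[0]? = some r
  parent : ∀ x ∈ l, x = r ∨ ∃ j < h, ∃ y, l[j]? = some y ∧ x ∈ D.children r y
  children : ∀ j < h, ∃ y, l[j]? = some y ∧ ∀ c ∈ D.children r y, ∃ i, j < i ∧ l[i]? = some c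

namespace TreeDecomposition

variable {V ι : Type*} {G : SimpleGraph V} {D : TreeDecomposition G ι} {r : ι}

theorem QueueOf.singleton : D.QueueOf r [r] 0 :=
  ⟨by simp, rfl, by simp, by simp⟩

/-- The queue cannot run dry early: if all its members have been processed, it contains the root and
is closed under children, so it contains all nodes. -/
theorem QueueOf.exists_getElem [Fintype ι] {l : List ι} {h : ℕ} (hl : D.QueueOf r l h)
    (hh : h < Fintype.card ι) : ∃ t, l[h]? = some t := by
  classical
  have hlen : h < l.length := by
    by_contra! hle
    have hall : ∀ x, x ∈ l := D.eq_univ_of_children_mem (S := {x | x ∈ l})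
      (List.mem_of_getElem? hl.head) (by
        intro t ht c hc
        obtain ⟨j, hj⟩ := List.mem_iff_getElem?.1 ht
        have hjl : j < l.length := (List.getElem?_eq_some_iff.1 hj).1
        obtain ⟨y, hy, hy'⟩ := hl.children j (by omega)
        rw [hj, Option.some.injEq] at hy
        obtain ⟨i, -, hi⟩ := hy' c (hy ▸ hc)
        exact List.mem_of_getElem? hi)
    have h₁ : l.toFinset = Finset.univ := by
      ext x
      simp [hall x]
    have h₂ := List.toFinset_card_of_nodup hl.nodup
    rw [h₁, Finset.card_univ] at h₂
    omega
  exact ⟨_, List.getElem?_eq_getElem hlen⟩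

/-- No node enters twice: parents are unique, and the children of `t` enter only when `t` is
processed. -/
theorem QueueOf.append {l : List ι} {h : ℕ} (hl : D.QueueOf r l h) {t : ι} (ht : l[h]? = some t)
    {L : List ι} (hL : L.Nodup) (hLt : ∀ v, v ∈ L ↔ v ∈ D.children r t) :
    D.QueueOf r (l ++ L) (h + 1) := by
  have hlt : ∀ {j x}, l[j]? = some x → (l ++ L)[j]? = some x := fun {j x} hj => by
    rw [List.getElem?_append_left (List.getElem?_eq_some_iff.1 hj).1, hj]
  have hhl : h < l.length := (List.getElem?_eq_some_iff.1 ht).1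
  refine ⟨?_, hlt hl.head, fun x hx => ?_, fun j hj => ?_⟩
  · refine List.nodup_append'.2 ⟨hl.nodup, hL, fun c hc hc' => ?_⟩
    rw [hLt] at hc'
    rcases hl.parent c hc with rfl | ⟨j, hj, y, hy, hcy⟩
    · have := D.dist_of_mem_children hc'
      simp at this
    · rw [D.eq_of_mem_children hcy hc', ← ht] at hy
      exact hj.ne ((List.getElem?_inj (by omega) hl.nodup).1 hy)
  · rcases List.mem_append.1 hx with hx | hx
    · rcases hl.parent x hx with h | ⟨j, hj, y, hy, hcy⟩
      · exact .inl h
      · exact .inr ⟨j, by omega, y, hlt hy, hcy⟩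
    · exact .inr ⟨h, by omega, t, hlt ht, (hLt x).1 hx⟩
  · rcases Nat.lt_succ_iff_lt_or_eq.1 hj with hj | rfl
    · obtain ⟨y, hy, hy'⟩ := hl.children j hj
      refine ⟨y, hlt hy, fun c hc => ?_⟩
      obtain ⟨i, hi, hi'⟩ := hy' c hc
      exact ⟨i, hi, hlt hi'⟩
    · refine ⟨t, hlt ht, fun c hc => ?_⟩
      obtain ⟨i, hi⟩ := List.mem_iff_getElem?.1 ((hLt c).2 hc)
      refine ⟨l.length + i, by omega, ?_⟩
      rw [List.getElem?_append_right (by omega), Nat.add_sub_cancel_left, hi]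

end TreeDecomposition

namespace RAM

/-- List the nodes of the tree in an order in which parents precede their children. -/
def listNodes : Program :=
  .seq (.write 14 (.const 0) (.reg 3)) (.seq (.assign 9 (.const 1)) (.for 8 (.reg 1)
    (.seq (.assign 10 (.read 14 (.reg 8))) (.for 11 (.read 4 (.reg 10))
      (.seq (.write 14 (.reg 9) (.read 5 (.add (.read 3 (.reg 10)) (.reg 11))))
        (.assign 9 (.add (.reg 9) (.const 1))))))))

/-- Breadth-first search, with array `14` as queue, register `8` as its reading position and
register `9` as its length. At most two children per node keep each round constant. -/
theorem within_listNodes {V : Type*} {N : ℕ} {G : SimpleGraph V} (D : TreeDecomposition G (Fin N))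
    (r : Fin N) (s : State) (hr : s.reg 3 = r) (hN : s.reg 1 = N)
    (hch : ∀ t : Fin N, Lists (s.arr 5) (s.arr 3 t) (s.arr 4 t) (D.children r t))
    (h2 : ∀ t : Fin N, s.arr 4 t ≤ 2) :
    Within listNodes s (100 * (N + 1)) fun s' => s'.arr 14 0 = r ∧
      (∀ i < N, ∃ t : Fin N, s'.arr 14 i = t ∧
        ∀ c ∈ D.children r t, ∃ j < N, i < j ∧ s'.arr 14 j = c) ∧
      ∀ i < N, ∀ j < N, s'.arr 14 i = s'.arr 14 j → i = j := by
  refine Within.mono (.seq (.write (.seq (.assign ((Within.for_const (n := N)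
    (K := 3 + (8 + 2 * 21)) (fun h s' => ∃ l, D.QueueOf r l h ∧ s'.reg 9 = l.length ∧
      ∀ (j : ℕ) (x : Fin N), l[j]? = some x → s'.arr 14 j = (x : ℕ)) ?_ ?_ ?_ ?_).mono le_rfl
      fun s' _ h => ?_)))))
      ?_ fun _ _ h => h
  · decide
  · intro s' h
    rw [Expr.eval, h.1 1 (by decide)]
    simp [hN]
  · refine ⟨[r], .singleton, by simp [Expr.eval], fun j x hj => ?_⟩
    rw [List.getElem?_singleton] at hj
    split_ifs at hj with h0
    · rw [Option.some.injEq] at hj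
      simp [h0, Expr.eval, hr, hj]
  · rintro h hh s' hag hreg ⟨l, hl, h9, hq⟩
    obtain ⟨t, ht⟩ := hl.exists_getElem (by simpa using hh)
    obtain ⟨L, hL, hLt, hlen, hcells⟩ := hch t
    have ha : ∀ a, a ≠ 14 → s'.arr a = s.arr a := fun a h => by
      rw [hag.2 a (by simpa [Program.for, Program.warrs] using h)]
      simp [h]
    have hev : (Expr.read 14 (.reg 8)).eval s' = t := by
      rw [Expr.eval, Expr.eval, hreg, hq h t ht]
    refine .seq (.assign ?_)
    rw [hev]
    refine (Within.for_const (n := s.arr 4 t) (K := 7 + 4)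
      (fun i s' => s'.reg 9 = l.length + i ∧
        ∀ (j : ℕ) (x : Fin N), (l ++ L.take i)[j]? = some x → s'.arr 14 j = (x : ℕ)) ?_ ?_ ?_ ?_).mono ?_
      fun s'' _ h' => ⟨l ++ L, hl.append ht hL hLt, ?_, ?_⟩
    · decide
    · intro s'' h'
      rw [Expr.eval, Expr.eval, h'.1 10 (by decide), h'.2 4 (by decide)]
      simp [ha]
    · simpa [h9] using hq
    · rintro i hi s'' h' hr' ⟨h₁, h₂⟩
      have h10 : s''.reg 10 = t := by
        rw [h'.1 10 (by decide)]
        simp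
      have ha' : ∀ a, a ≠ 14 → s''.arr a = s.arr a := fun a h => by
        rw [h'.2 a (by simpa [Program.for, Program.warrs] using h)]
        exact ha a h
      refine Within.mono (.seq (.write (.assign ⟨?_, ?_⟩))) (by simp [Expr.cost]) fun _ _ h => h
      · simp [Expr.eval, h₁]
        omega
      · intro j x hj
        have hi' : i < L.length := hlen ▸ hi
        have hlt : (l ++ L.take i).length = l.length + i := by simp; omega
        rw [List.take_succ_eq_append_getElem hi', ← List.append_assoc, List.getElem?_append,
          hlt] at hj
        simp only [Expr.eval, State.setReg_arr, State.setArr_arr, if_true, h₁,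
          Function.update_apply, h10, hr', ha' 5 (by decide), ha' 3 (by decide)]
        split_ifs at hj with h'
        · rw [if_neg (by omega)]
          exact h₂ j x hj
        · rw [List.getElem?_singleton] at hj
          split_ifs at hj with h''
          · rw [if_pos (by omega), hcells i hi']
            rw [Option.some.injEq] at hj
            rw [hj]
    · have := Nat.mul_le_mul_right (7 + 4 + 3 + 7) (h2 t)
      simp only [Expr.cost]
      omega
    · simp [h'.1, hlen]
    · intro j x hj
      refine h'.2 j x ?_
      rwa [← hlen, List.take_length]
  · obtain ⟨l, hl, -, hq⟩ := h
    have hle : l.length ≤ N := by simpa using hl.nodup.length_le_card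
    refine ⟨hq 0 r hl.head, fun i hi => ?_, fun i hi j hj hij => ?_⟩
    · obtain ⟨t, ht, ht'⟩ := hl.children i hi
      refine ⟨t, hq i t ht, fun c hc => ?_⟩
      obtain ⟨j, hij, hj⟩ := ht' c hc
      exact ⟨j, (List.getElem?_eq_some_iff.1 hj).1.trans_le hle, hij, hq j c hj⟩
    · obtain ⟨x, hx, -⟩ := hl.children i hi
      obtain ⟨y, hy, -⟩ := hl.children j hj
      rw [hq i x hx, hq j y hy] at hij
      obtain rfl := Fin.ext hij
      exact (List.getElem?_inj (List.getElem?_eq_some_iff.1 hx).1 hl.nodup).1 (hx.trans hy.symm)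
  · simp only [Expr.cost]
    omega

/-! ### The formulas of the dynamic program -/

namespace Formula

def all (e : Expr) (φ : Formula) : Formula := .neg (.ex e (.neg φ))

def imp (φ ψ : Formula) : Formula := .neg (.and φ (.neg ψ))

def lt (e₁ e₂ : Expr) : Formula := .atom (.sub e₂ e₁)

def eq (e₁ e₂ : Expr) : Formula := .neg (.atom (.add (.sub e₁ e₂) (.sub e₂ e₁)))

variable {b B : ℕ} {s : State} {e e₁ e₂ : Expr} {φ ψ : Formula}

theorem holds_all : (all e φ).Holds b s ↔ ∀ v < e.eval s, φ.Holds (b + 1) (s.setReg b v) := by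
  simp [all, Holds]

theorem holds_imp : (imp φ ψ).Holds b s ↔ (φ.Holds b s → ψ.Holds b s) := by
  simp [imp, Holds]

theorem holds_lt : (lt e₁ e₂).Holds b s ↔ e₁.eval s < e₂.eval s := by
  simp only [lt, Holds, Expr.eval]
  omega

theorem holds_eq : (eq e₁ e₂).Holds b s ↔ e₁.eval s = e₂.eval s := by
  simp only [eq, Holds, Expr.eval]
  omega

theorem holds_and : (Formula.and φ ψ).Holds b s ↔ φ.Holds b s ∧ ψ.Holds b s := Iff.rfl

theorem holds_ex :
    (ex e φ).Holds b s ↔ ∃ v < e.eval s, φ.Holds (b + 1) (s.setReg b v) := Iff.rfl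

theorem holds_atom : (atom e).Holds b s ↔ e.eval s ≠ 0 := Iff.rfl

theorem bounded_all : (all e φ).Bounded B b s ↔
    e.eval s ≤ B ∧ ∀ v < e.eval s, φ.Bounded B (b + 1) (s.setReg b v) := Iff.rfl

theorem bounded_imp : (imp φ ψ).Bounded B b s ↔ φ.Bounded B b s ∧ ψ.Bounded B b s := Iff.rfl

theorem bounded_lt : (lt e₁ e₂).Bounded B b s ↔ True := Iff.rfl

theorem bounded_eq : (eq e₁ e₂).Bounded B b s ↔ True := Iff.rfl

theorem bounded_and :
    (Formula.and φ ψ).Bounded B b s ↔ φ.Bounded B b s ∧ ψ.Bounded B b s := Iff.rfl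

theorem bounded_ex : (ex e φ).Bounded B b s ↔
    e.eval s ≤ B ∧ ∀ v < e.eval s, φ.Bounded B (b + 1) (s.setReg b v) := Iff.rfl

theorem bounded_atom : (atom e).Bounded B b s ↔ True := Iff.rfl

/-- The nesting depth of the quantifiers of a formula. -/
def depth : Formula → ℕ
  | .atom _ => 0
  | .neg φ => φ.depth
  | .and φ ψ => max φ.depth ψ.depth
  | .ex _ φ => φ.depth + 1

/-- Each quantifier contributes one factor `B`, so nesting depth bounds the degree of the running
time. -/
theorem exists_time_le (φ : Formula) : ∃ K, ∀ B, 1 ≤ B → φ.time B ≤ K * B ^ φ.depth := by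
  induction φ with
  | atom e => exact ⟨e.cost + 1, fun B _ => by simp [time, depth]⟩
  | neg φ ih =>
    obtain ⟨K, hK⟩ := ih
    refine ⟨K + 4, fun B hB => ?_⟩
    have := Nat.one_le_pow φ.depth B hB
    have := hK B hB
    simp only [time, depth, Nat.add_mul]
    omega
  | and φ ψ ih ih' =>
    obtain ⟨K, hK⟩ := ih
    obtain ⟨K', hK'⟩ := ih'
    refine ⟨K + (K' + 3), fun B hB => ?_⟩
    have h₁ := Nat.one_le_pow (max φ.depth ψ.depth) B hB
    have h₂ := (hK B hB).trans
      (Nat.mul_le_mul_left K (Nat.pow_le_pow_right hB (le_max_left φ.depth ψ.depth)))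
    have h₃ := (hK' B hB).trans
      (Nat.mul_le_mul_left K' (Nat.pow_le_pow_right hB (le_max_right φ.depth ψ.depth)))
    simp only [time, depth, Nat.add_mul]
    omega
  | ex e φ ih =>
    obtain ⟨K, hK⟩ := ih
    refine ⟨e.cost + 7 + (K + (2 * e.cost + 9)), fun B hB => ?_⟩
    have h₁ := Nat.one_le_pow φ.depth B hB
    have h₂ := Nat.one_le_pow (φ.depth + 1) B hB
    have h₃ : B * (φ.time B + 2 * e.cost + 9) ≤ (K + (2 * e.cost + 9)) * B ^ (φ.depth + 1) := by
      rw [pow_succ', Nat.mul_left_comm]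
      refine Nat.mul_le_mul_left B ?_
      have := hK B hB
      have := Nat.mul_le_mul_left (2 * e.cost + 9) h₁
      rw [Nat.add_mul]
      omega
    have h₄ := Nat.mul_le_mul_left (e.cost + 7) h₂
    simp only [time, depth]
    rw [Nat.add_mul (e.cost + 7)]
    omega

end Formula

/-- The length of the list of the bag of a node. -/
def lenExpr (t : Expr) : Expr := .read 7 t

/-- The vertex at a position of the list of the bag of a node. -/
def vertExpr (t i : Expr) : Expr := .read 8 (.add (.read 6 t) i)

/-- The color that a state gives to a position. -/
def colExpr (σ i : Expr) : Expr := .read 12 (.add (.read 11 σ) i)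

/-- The rank that a state gives to a position. -/
def rankExpr (σ i : Expr) : Expr := .read 12 (.add (.read 11 σ) (.add (.reg 5) i))

/-- The child of the node in register `10` whose index is in register `12`. -/
def childExpr : Expr := .read 5 (.add (.read 3 (.reg 10)) (.reg 12))

/-- The state in register `11` is valid at the node in register `10`. -/
def validFormula : Formula :=
  .all (lenExpr (.reg 10)) (.and (.lt (colExpr (.reg 11) (.reg 12)) (.reg 2))
    (.all (lenExpr (.reg 10))
      (.imp (.atom (.read 10 (.add (.read 9 (vertExpr (.reg 10) (.reg 12)))
          (vertExpr (.reg 10) (.reg 13)))))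
        (.imp (.eq (colExpr (.reg 11) (.reg 12)) (colExpr (.reg 11) (.reg 13)))
          (.lt (rankExpr (.reg 11) (.reg 12)) (rankExpr (.reg 11) (.reg 13)))))))

/-- The state in register `11` at the node in register `10` is compatible with the state in
register `13` at the child whose index is in register `12`. -/
def compatFormula : Formula :=
  .all (lenExpr (.reg 10)) (.all (lenExpr childExpr)
    (.imp (.eq (vertExpr (.reg 10) (.reg 14)) (vertExpr childExpr (.reg 15)))
      (.and (.eq (colExpr (.reg 11) (.reg 14)) (colExpr (.reg 13) (.reg 15)))
        (.all (lenExpr (.reg 10)) (.all (lenExpr childExpr)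
          (.imp (.eq (vertExpr (.reg 10) (.reg 16)) (vertExpr childExpr (.reg 17)))
            (.and
              (.imp (.lt (rankExpr (.reg 11) (.reg 14)) (rankExpr (.reg 11) (.reg 16)))
                (.lt (rankExpr (.reg 13) (.reg 15)) (rankExpr (.reg 13) (.reg 17))))
              (.imp (.lt (rankExpr (.reg 13) (.reg 15)) (rankExpr (.reg 13) (.reg 17)))
                (.lt (rankExpr (.reg 11) (.reg 14)) (rankExpr (.reg 11) (.reg 16)))))))))))

/-- The state in register `11` is feasible at the node in register `10`, in terms of the tables of
the children of this node. -/
def feasibleFormula : Formula :=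
  .and validFormula (.all (.read 4 (.reg 10)) (.ex (.reg 7)
    (.and (.atom (.read 15 (.add (.read 13 childExpr) (.reg 13)))) compatFormula)))

/-- The store contains the data that the dynamic program needs. -/
structure Prepared {n N : ℕ} (M : Scheme (Fin n) (Fin N)) (G : Digraph (Fin n))
    (children : Fin N → Set (Fin N)) (m k : ℕ) (s : State) : Prop where
  reg_two : s.reg 2 = k
  reg_five : s.reg 5 = m
  reg_seven : s.reg 7 = M.numStates
  len : ∀ t : Fin N, s.arr 7 t = M.len t
  len_le : ∀ t, M.len t ≤ m
  vert : ∀ (t : Fin N), ∀ i < M.len t, s.arr 8 (s.arr 6 t + i) = M.vert t i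
  adj : ∀ u v : Fin n, s.arr 10 (s.arr 9 u + v) ≠ 0 ↔ G.Adj u v
  col : ∀ σ < M.numStates, ∀ i < m, s.arr 12 (s.arr 11 σ + i) = M.col σ i
  rank : ∀ σ < M.numStates, ∀ i < m, s.arr 12 (s.arr 11 σ + (m + i)) = M.rank σ i
  children : ∀ t : Fin N, Lists (s.arr 5) (s.arr 3 t) (s.arr 4 t) (children t)
  card_children : ∀ t : Fin N, s.arr 4 t ≤ 2
  table : ∀ t : Fin N, s.arr 13 t = t * M.numStates

variable {n N m k : ℕ} {M : Scheme (Fin n) (Fin N)} {G : Digraph (Fin n)}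
  {children : Fin N → Set (Fin N)} {s : State}

/-! ### Meaning of the formulas on a prepared store -/

theorem Lists.mem_iff {cells : ℕ → ℕ} {start len m : ℕ} {S : Set (Fin m)}
    (h : Lists cells start len S) {v : Fin m} : v ∈ S ↔ ∃ j < len, cells (start + j) = v := by
  obtain ⟨L, -, hL, hlen, hcells⟩ := h
  rw [← hL, List.mem_iff_getElem]
  constructor
  · rintro ⟨j, hj, rfl⟩
    exact ⟨j, hlen ▸ hj, hcells j hj⟩
  · rintro ⟨j, hj, h⟩
    exact ⟨j, hlen ▸ hj, Fin.ext ((hcells j (hlen ▸ hj)).symm.trans h)⟩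

theorem Lists.exists_mem {cells : ℕ → ℕ} {start len m : ℕ} {S : Set (Fin m)}
    (h : Lists cells start len S) {j : ℕ} (hj : j < len) :
    ∃ v ∈ S, cells (start + j) = (v : ℕ) := by
  obtain ⟨L, -, hL, hlen, hcells⟩ := h
  exact ⟨L[j]'(hlen ▸ hj), (hL _).1 (List.getElem_mem _), hcells j (hlen ▸ hj)⟩

theorem Prepared.holds_valid (hs : Prepared M G children m k s) {t : Fin N} {σ : ℕ}
    (ht : s.reg 10 = t) (hσ : s.reg 11 = σ) (hσM : σ < M.numStates) :
    validFormula.Holds 12 s ↔ M.Valid G k t σ := by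
  simp only [validFormula, Formula.holds_all, Formula.holds_and, Formula.holds_lt,
    Formula.holds_imp, Formula.holds_eq, Formula.holds_atom, lenExpr, colExpr, rankExpr, vertExpr,
    Expr.eval, State.setReg_reg, State.setReg_arr, ht, hσ, hs.reg_two, hs.reg_five, Nat.reduceAdd,
    Nat.reduceEqDiff, if_true, if_false, hs.len]
  refine forall₂_congr fun i hi => ?_
  have hi' := hi.trans_le (hs.len_le t)
  rw [hs.col σ hσM i hi']
  refine and_congr Iff.rfl (forall₂_congr fun j hj => ?_)
  have hj' := hj.trans_le (hs.len_le t)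
  rw [hs.vert t i hi, hs.vert t j hj, hs.adj, hs.col σ hσM j hj', hs.rank σ hσM i hi',
    hs.rank σ hσM j hj']

theorem Prepared.holds_compat (hs : Prepared M G children m k s) {t c : Fin N} {σ σ' : ℕ}
    (ht : s.reg 10 = t) (hσ : s.reg 11 = σ) (hσM : σ < M.numStates)
    (hc : s.arr 5 (s.arr 3 t + s.reg 12) = c) (hσ' : s.reg 13 = σ') (hσM' : σ' < M.numStates) :
    compatFormula.Holds 14 s ↔ M.Compat t σ c σ' := by
  simp only [compatFormula, Formula.holds_all, Formula.holds_and, Formula.holds_lt,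
    Formula.holds_imp, Formula.holds_eq, lenExpr, colExpr, rankExpr, vertExpr,
    childExpr, Expr.eval, State.setReg_reg, State.setReg_arr, ht, hσ, hσ', hc, hs.reg_five,
    Nat.reduceAdd, Nat.reduceEqDiff, if_true, if_false, hs.len]
  refine forall₂_congr fun i hi => forall₂_congr fun i' hi' => ?_
  have hi₁ := hi.trans_le (hs.len_le t)
  have hi₁' := hi'.trans_le (hs.len_le c)
  rw [hs.vert t i hi, hs.vert c i' hi', Fin.val_inj, hs.col σ hσM i hi₁, hs.col σ' hσM' i' hi₁',
    hs.rank σ hσM i hi₁, hs.rank σ' hσM' i' hi₁']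
  refine imp_congr Iff.rfl (and_congr Iff.rfl
    (forall₂_congr fun j hj => forall₂_congr fun j' hj' => ?_))
  have hj₁ := hj.trans_le (hs.len_le t)
  have hj₁' := hj'.trans_le (hs.len_le c)
  rw [hs.vert t j hj, hs.vert c j' hj', Fin.val_inj, hs.rank σ hσM j hj₁,
    hs.rank σ' hσM' j' hj₁']
  exact imp_congr Iff.rfl iff_def.symm

theorem Prepared.setReg (hs : Prepared M G children m k s) {x v : ℕ} (hx : 8 ≤ x) :
    Prepared M G children m k (s.setReg x v) :=
  { hs with
    reg_two := by rw [State.setReg_reg, if_neg (by omega), hs.reg_two]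
    reg_five := by rw [State.setReg_reg, if_neg (by omega), hs.reg_five]
    reg_seven := by rw [State.setReg_reg, if_neg (by omega), hs.reg_seven] }

/-- Once the tables of the children are correct, the formula is literally the recursion
`Scheme.feasible_iff`. -/
theorem Prepared.holds_feasible (hs : Prepared M G children m k s) {t : Fin N} {σ : ℕ}
    (ht : s.reg 10 = t) (hσ : s.reg 11 = σ) (hσM : σ < M.numStates)
    (htable : ∀ c ∈ children t, ∀ σ' < M.numStates,
      s.arr 15 (s.arr 13 c + σ') ≠ 0 ↔ M.Feasible G k children c σ') :
    feasibleFormula.Holds 12 s ↔ M.Feasible G k children t σ := by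
  rw [Scheme.feasible_iff, feasibleFormula, Formula.holds_and, hs.holds_valid ht hσ hσM,
    Formula.holds_all]
  refine and_congr Iff.rfl ?_
  have key : ∀ i < s.arr 4 t, ∀ c ∈ children t, s.arr 5 (s.arr 3 t + i) = c →
      ((Formula.ex (.reg 7) (.and (.atom (.read 15 (.add (.read 13 childExpr) (.reg 13))))
        compatFormula)).Holds 13 (s.setReg 12 i) ↔
        ∃ σ' < M.numStates, M.Feasible G k children c σ' ∧ M.Compat t σ c σ') := by
    intro i hi c hc hic
    have h7 : (Expr.reg 7).eval (s.setReg 12 i) = M.numStates := by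
      simp [Expr.eval, hs.reg_seven]
    rw [Formula.holds_ex, h7]
    refine exists_congr fun σ' => and_congr_right fun hσ' => ?_
    rw [Formula.holds_and, ((hs.setReg (by decide)).setReg (by decide)).holds_compat (c := c)
      (σ := σ) (σ' := σ') (t := t) (by simp [ht]) (by simp [hσ]) hσM (by simpa using hic) (by simp)
      hσ', ← htable c hc σ' hσ']
    simp [Formula.holds_atom, childExpr, Expr.eval, ht, hic]
  have h4 : (Expr.read 4 (.reg 10)).eval s = s.arr 4 t := by simp [Expr.eval, ht]
  rw [h4]
  constructor
  · intro h c hc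
    obtain ⟨i, hi, hic⟩ := (hs.children t).mem_iff.1 hc
    exact (key i hi c hc hic).1 (h i hi)
  · intro h i hi
    obtain ⟨c, hc, hic⟩ := (hs.children t).exists_mem hi
    exact (key i hi c hc hic).2 (h c hc)

/-- The quantifiers range over bag positions, at most two children, or states; the number of states
crudely bounds all three. -/
theorem Prepared.bounded_feasible (hs : Prepared M G children m k s) {t : Fin N}
    (ht : s.reg 10 = t) (hm : m ≤ M.numStates) (h2 : 2 ≤ M.numStates) :
    feasibleFormula.Bounded M.numStates 12 s := by
  have hlen : ∀ t, M.len t ≤ M.numStates := fun t => (hs.len_le t).trans hm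
  simp only [feasibleFormula, validFormula, compatFormula, Formula.bounded_all,
    Formula.bounded_and, Formula.bounded_lt, Formula.bounded_ex,
    Formula.bounded_imp, Formula.bounded_eq, Formula.bounded_atom, lenExpr, colExpr, rankExpr,
    vertExpr, childExpr, Expr.eval, State.setReg_reg, State.setReg_arr, ht, hs.reg_seven,
    Nat.reduceAdd, Nat.reduceEqDiff, if_true, if_false, hs.len, and_true,
    true_and, implies_true, le_refl, hlen, (hs.card_children t).trans h2]
  intro i hi
  obtain ⟨c, -, hic⟩ := (hs.children t).exists_mem hi
  simp only [hic, hs.len, hlen, implies_true, and_true]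

end RAM

namespace RAM

/-! ### The program -/

/-- Compute the tables of the nodes, children first. -/
def fillTables : Program :=
  .for 8 (.reg 1) (.seq (.assign 10 (.read 14 (.sub (.sub (.reg 1) (.const 1)) (.reg 8))))
    (.for 11 (.reg 7) (.seq (feasibleFormula.compile 12)
      (.write 15 (.add (.read 13 (.reg 10)) (.reg 11)) (.reg 0)))))

/-- Look for a feasible state at the root. -/
def answer : Program :=
  .seq ((Formula.ex (.reg 7) (.atom (.read 15 (.add (.read 13 (.reg 3)) (.reg 12))))).compile 12)
    (.ite (.reg 0) (.assign 0 (.const 1)) (.assign 0 (.const 0)))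

/-- The dynamic program. -/
def solve : Program :=
  .seq (mulTable 9 4 4) (.seq markArcs (.seq countStates (.seq (mulTable 11 7 6)
    (.seq digitTable (.seq (mulTable 13 1 7) (.seq listNodes (.seq fillTables answer)))))))

/-- If the number of colors is at least the size of the largest bag, the answer is yes. Otherwise
run the dynamic program. -/
def decideColorable : Program :=
  .seq (.assign 4 (.reg 0)) (.seq maxLen (.ite (.sub (.reg 5) (.reg 2)) solve
    (.assign 0 (.const 1))))

variable {n N m k : ℕ} {M : Scheme (Fin n) (Fin N)} {G : Digraph (Fin n)}
  {children : Fin N → Set (Fin N)} {s s' : State}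

/-! ### Correctness of the tables and of the final search -/

theorem Prepared.congr (hs : Prepared M G children m k s)
    (hr : ∀ x, 0 < x → x < 8 → s'.reg x = s.reg x) (ha : ∀ a < 14, s'.arr a = s.arr a) :
    Prepared M G children m k s' where
  reg_two := (hr 2 (by decide) (by decide)).trans hs.reg_two
  reg_five := (hr 5 (by decide) (by decide)).trans hs.reg_five
  reg_seven := (hr 7 (by decide) (by decide)).trans hs.reg_seven
  len := by simpa only [ha 7 (by decide)] using hs.len
  len_le := hs.len_le
  vert := by simpa only [ha 6 (by decide), ha 8 (by decide)] using hs.vert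
  adj := by simpa only [ha 9 (by decide), ha 10 (by decide)] using hs.adj
  col := by simpa only [ha 11 (by decide), ha 12 (by decide)] using hs.col
  rank := by simpa only [ha 11 (by decide), ha 12 (by decide)] using hs.rank
  children := by
    simpa only [ha 3 (by decide), ha 4 (by decide), ha 5 (by decide)] using hs.children
  card_children := by simpa only [ha 4 (by decide)] using hs.card_children
  table := by simpa only [ha 13 (by decide)] using hs.table

theorem Formula.warrs_compile {φ : Formula} : ∀ {b : ℕ}, (φ.compile b).warrs = [] := by
  induction φ with
  | atom e => simp [Formula.compile, Program.warrs]
  | neg φ ih => simp [Formula.compile, Program.warrs, ih]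
  | and φ ψ ih ih' => simp [Formula.compile, Program.warrs, ih, ih']
  | ex e φ ih => simp [Formula.compile, Program.warrs, ih]

theorem regs_fillTables : ∀ x < 8, 0 < x → x ∉ fillTables.wregs := by decide

theorem arrs_fillTables {a : ℕ} (h : a ≠ 15) : a ∉ fillTables.warrs := by
  simp [fillTables, Program.for, Program.warrs, Formula.warrs_compile, h]

/-- In the list of nodes children come after their parents, so working from its end backwards finds
the tables of the children complete. -/
theorem within_fillTables (hs : Prepared M G children m k s) (hN : s.reg 1 = N)
    (hm : m ≤ M.numStates) (h2 : 2 ≤ M.numStates)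
    (hq : ∀ i < N, ∃ t : Fin N, s.arr 14 i = t ∧
      ∀ c ∈ children t, ∃ j < N, i < j ∧ s.arr 14 j = c)
    (hinj : ∀ i < N, ∀ j < N, s.arr 14 i = s.arr 14 j → i = j) :
    Within fillTables s (6 + N * (M.numStates * (feasibleFormula.time M.numStates + 14) + 21))
      fun s' => ∀ i < N, ∀ t : Fin N, s.arr 14 i = t → ∀ σ < M.numStates,
        s'.arr 15 (t * M.numStates + σ) ≠ 0 ↔ M.Feasible G k children t σ := by
  set S := M.numStates with hS
  have hreg : ∀ {s'}, Agree fillTables s s' → ∀ x, 0 < x → x < 8 → s'.reg x = s.reg x :=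
    fun h x hx hx' => h.1 x (regs_fillTables x hx' hx)
  have harr : ∀ {s'}, Agree fillTables s s' → ∀ a, a ≠ 15 → s'.arr a = s.arr a :=
    fun h a ha => h.2 a (arrs_fillTables ha)
  refine Within.mono (Within.for_const (n := N)
    (K := 7 + (6 + S * ((feasibleFormula.time S + 6) + 1 + 7)))
    (fun h s' => ∀ i, N - h ≤ i → i < N → ∀ t : Fin N, s.arr 14 i = t → ∀ σ < S,
      s'.arr 15 (t * S + σ) ≠ 0 ↔ M.Feasible G k children t σ) ?_ ?_ ?_ ?_) ?_
      fun s' _ h i hi => h i (by omega) hi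
  · decide
  · intro s' h
    rw [Expr.eval, hreg h 1 (by decide) (by decide), hN]
  · intro i hi hi'
    omega
  · intro h hh s' hag h8 htab
    -- Round `h` treats position `N - 1 - h`; the positions from `N - h` on are finished.
    obtain ⟨t, ht, hct⟩ := hq (N - 1 - h) (by omega)
    have hev : (Expr.read 14 (.sub (.sub (.reg 1) (.const 1)) (.reg 8))).eval s' = t := by
      simp only [Expr.eval]
      rw [h8, hreg hag 1 (by decide) (by decide), hN, harr hag 14 (by decide), ht]
    have hreg' : ∀ {s''}, Agree (.for 11 (.reg 7) (.seq (feasibleFormula.compile 12)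
        (.write 15 (.add (.read 13 (.reg 10)) (.reg 11)) (.reg 0)))) (s'.setReg 10 t) s'' →
        ∀ x, 0 < x → x < 11 → s''.reg x = (s'.setReg 10 t).reg x := by
      have : ∀ x < 11, 0 < x → x ∉ (Program.for 11 (.reg 7) (.seq (feasibleFormula.compile 12)
        (.write 15 (.add (.read 13 (.reg 10)) (.reg 11)) (.reg 0)))).wregs := by decide
      intro s'' h x hx hx'
      exact h.1 x (this x hx' hx)
    have harr' : ∀ {s''}, Agree (.for 11 (.reg 7) (.seq (feasibleFormula.compile 12)
        (.write 15 (.add (.read 13 (.reg 10)) (.reg 11)) (.reg 0)))) (s'.setReg 10 t) s'' →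
        ∀ a, a ≠ 15 → s''.arr a = s.arr a := by
      refine fun h a ha => (h.2 a ?_).trans (harr hag a ha)
      simp [Program.for, Program.warrs, Formula.warrs_compile, ha]
    refine .seq (.assign ?_)
    rw [hev]
    refine (Within.for_const (n := S)
      (K := feasibleFormula.time S + 6)
      (fun j s' => (∀ i, N - h ≤ i → i < N → ∀ t : Fin N, s.arr 14 i = t → ∀ σ < S,
        s'.arr 15 (t * S + σ) ≠ 0 ↔ M.Feasible G k children t σ) ∧ ∀ σ < j,
        (s'.arr 15 (t * S + σ) ≠ 0 ↔ M.Feasible G k children t σ)) ?_ ?_ ?_ ?_).mono le_rfl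
        fun s'' _ h' => ?_
    · decide
    · intro s'' h'
      rw [Expr.eval, hreg' h' 7 (by decide) (by decide), State.setReg_reg, if_neg (by decide),
        hreg hag 7 (by decide) (by decide), hs.reg_seven]
    · exact ⟨htab, fun _ h => absurd h (Nat.not_lt_zero _)⟩
    · rintro σ hσ s'' h' h11 ⟨htab', hσtab⟩
      have h10 : s''.reg 10 = t := by
        rw [hreg' h' 10 (by decide) (by decide)]
        simp
      have hs'' : Prepared M G children m k s'' := by
        refine hs.congr (fun x hx hx' => ?_) fun a ha => harr' h' a (by omega)
        rw [hreg' h' x hx (by omega), State.setReg_reg, if_neg (by omega), hreg hag x hx hx']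
      have hfeas := hs''.holds_feasible h10 h11 hσ (by
        intro c hc σ' hσ'
        obtain ⟨j, hj, hij, hjc⟩ := hct c hc
        rw [hs''.table c]
        exact htab' j (by omega) hj c hjc σ' hσ')
      refine .seq (((Formula.within_compile (by decide) (by decide)
        (hs''.bounded_feasible h10 hm h2))).mono le_rfl fun s₃ _ h₃ => ?_)
      refine Within.mono (K := 6) (.write ?_) (by omega) fun _ _ h => h
      have hidx : (Expr.add (.read 13 (.reg 10)) (.reg 11)).eval s₃ = t * S + σ := by
        simp only [Expr.eval]
        rw [h₃.1.2 10 (by decide) (by decide), h₃.1.2 11 (by decide) (by decide), h₃.1.1, h10, h11,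
          hs''.table]
      have h0 : (Expr.reg 0).eval s₃ ≠ 0 ↔ M.Feasible G k children t σ := h₃.2.trans hfeas
      rw [hidx]
      refine ⟨fun i hi hiN t' ht' σ' hσ' => ?_, fun σ' hσ' => ?_⟩
      · simp only [State.setReg_arr, State.setArr_arr, if_true, Function.update_apply]
        split_ifs with heq
        -- Writing to row `t` spoils no finished row, because the list has no repetitions.
        · rw [mul_add_inj hσ' hσ, Fin.val_inj] at heq
          have := hinj _ hiN _ (by omega) (ht'.trans ((congrArg Fin.val heq.1).trans ht.symm))
          omega
        · rw [h₃.1.1]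
          exact htab' i hi hiN t' ht' σ' hσ'
      · simp only [State.setReg_arr, State.setArr_arr, if_true, Function.update_apply]
        split_ifs with heq
        · rw [mul_add_inj (by omega) hσ] at heq
          rw [heq.2]
          exact h0
        · rw [h₃.1.1]
          exact hσtab σ' (by
            rcases Nat.lt_succ_iff_lt_or_eq.1 hσ' with h | h
            · exact h
            · exact absurd (by rw [h]) heq)
    · intro i hi hiN t' ht' σ hσ
      by_cases hi' : N - h ≤ i
      · exact h'.1 i hi' hiN t' ht' σ hσ
      · obtain rfl : i = N - 1 - h := by omega
        obtain rfl : t = t' := Fin.ext (ht.symm.trans ht')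
        exact h'.2 σ hσ
  · simp only [Expr.cost]
    have : N * (7 + (6 + S * (feasibleFormula.time S + 6 + 1 + 7)) + 1 + 7) =
      N * (S * (feasibleFormula.time S + 14) + 21) := by ring
    omega

/-- A compiled formula only promises a nonzero result for truth; the last test normalizes it to `1`.
-/
theorem within_answer {q : Prop} {r : ℕ} {S : ℕ} (h3 : s.reg 3 = r) (h7 : s.reg 7 = S)
    (h13 : s.arr 13 r = r * S) (hq : q ↔ ∃ σ < S, s.arr 15 (r * S + σ) ≠ 0) :
    Within answer s (20 + 30 * S) fun s' => (q → s'.reg 0 = 1) ∧ (¬ q → s'.reg 0 = 0) := by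
  have hB : (Formula.ex (.reg 7) (.atom (.read 15 (.add (.read 13 (.reg 3)) (.reg 12))))).Bounded
      S 12 s := ⟨h7.le, fun _ _ => trivial⟩
  refine Within.mono (.seq ((Formula.within_compile (by decide) (by decide) hB).mono le_rfl
    fun s' _ h => Within.ite (K := 2) (fun h0 => .assign ?_) (fun h0 => .assign ?_))) ?_
    fun _ _ h => h
  · have := h.2.1 h0
    simp only [Formula.holds_ex, Formula.holds_atom, Expr.eval, State.setReg_reg, if_true,
      Nat.reduceEqDiff, if_false, State.setReg_arr, h3, h7, h13] at this
    exact ⟨fun _ => rfl, fun h => absurd (hq.2 this) h⟩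
  · have := mt h.2.2 (not_not_intro h0)
    simp only [Formula.holds_ex, Formula.holds_atom, Expr.eval, State.setReg_reg, if_true,
      Nat.reduceEqDiff, if_false, State.setReg_arr, h3, h7, h13] at this
    exact ⟨fun h => absurd (hq.1 h) this, fun _ => rfl⟩
  · simp only [Formula.time, Expr.cost]
    omega

/-! ### Sizes of the input -/

theorem Lists.len_eq_ncard {cells : ℕ → ℕ} {start len m : ℕ} {S : Set (Fin m)}
    (h : Lists cells start len S) : len = S.ncard := by
  obtain ⟨L, hL, hLS, hlen, -⟩ := h
  have : S = (L.toFinset : Set (Fin m)) := by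
    ext v
    simp [hLS]
  rw [this, Set.ncard_coe_finset, List.toFinset_card_of_nodup hL, hlen]

/-- Positions beyond the list receive the junk value `0`, which exists in `Fin m` because `m` is
positive. -/
theorem Lists.exists_enum {cells : ℕ → ℕ} {start len m : ℕ} {S : Set (Fin m)} (hm : 0 < m)
    (h : Lists cells start len S) : ∃ x : ℕ → Fin m, (∀ i < len, cells (start + i) = (x i : ℕ)) ∧
      (∀ i < len, ∀ j < len, x i = x j → i = j) ∧ ∀ v, v ∈ S ↔ ∃ i < len, x i = v := by
  obtain ⟨L, hL, hLS, rfl, hcells⟩ := h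
  have hget : ∀ i (hi : i < L.length), L.getD i ⟨0, hm⟩ = L[i] := fun i hi => by simp [hi]
  refine ⟨fun i => L.getD i ⟨0, hm⟩, fun i hi => ?_, fun i hi j hj hij => ?_, fun v => ?_⟩
  · simp only [hget i hi]
    exact hcells i hi
  · simp only [hget i hi, hget j hj] at hij
    exact (hL.getElem_inj_iff).1 hij
  · rw [← hLS, List.mem_iff_getElem]
    constructor
    · rintro ⟨i, hi, rfl⟩
      exact ⟨i, hi, hget i hi⟩
    · rintro ⟨i, hi, rfl⟩
      exact ⟨i, hi, (hget i hi).symm⟩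

/-- Every arc is a pair inside one of the `N` bags, and each bag has at most `m ^ 2` pairs. -/
theorem sum_ncard_adj_le (hG : ∀ v, ¬ G.Adj v v)
    (D : TreeDecomposition G.toSimpleGraphInclusive (Fin N)) (hm : ∀ t, (D.bag t).card ≤ m) :
    ∑ u : Fin n, {v | G.Adj u v}.ncard ≤ N * m ^ 2 := by
  classical
  have h₁ : ∑ u : Fin n, {v | G.Adj u v}.ncard =
      (Finset.univ.sigma fun u => Finset.univ.filter fun v => G.Adj u v).card := by
    rw [Finset.card_sigma]
    refine Finset.sum_congr rfl fun u _ => ?_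
    rw [← Set.ncard_coe_finset]
    simp
  have h₂ : ((Finset.univ.sigma fun u => Finset.univ.filter fun v => G.Adj u v).image
      fun p => (p.1, p.2)) ⊆ Finset.univ.biUnion fun t => D.bag t ×ˢ D.bag t := by
    intro p hp
    simp only [Finset.mem_image, Finset.mem_sigma, Finset.mem_filter] at hp
    obtain ⟨⟨u, v⟩, ⟨-, -, huv⟩, rfl⟩ := hp
    obtain ⟨t, hu, hv⟩ := Digraph.exists_mem_bag_of_adj D hG huv
    simp only [Finset.mem_biUnion, Finset.mem_product]
    exact ⟨t, Finset.mem_univ t, hu, hv⟩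
  rw [h₁, ← Finset.card_image_of_injective (f := fun p : (_ : Fin n) × Fin n => (p.1, p.2)) _ (by
    rintro ⟨a, b⟩ ⟨c, d⟩ h
    simp only [Prod.mk.injEq] at h
    rw [h.1, h.2])]
  refine (Finset.card_le_card h₂).trans (Finset.card_biUnion_le.trans ?_)
  refine (Finset.sum_le_card_nsmul _ _ (m ^ 2) fun t _ => ?_).trans (by simp)
  rw [Finset.card_product, pow_two]
  exact Nat.mul_le_mul (hm t) (hm t)

end RAM

/-- The only property of nice decompositions that the algorithm uses. -/
theorem NiceTreeDecomposition.ncard_children_le {V ι : Type*} [DecidableEq V] {H : SimpleGraph V}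
    (D : NiceTreeDecomposition H ι) (t : ι) :
    (D.toTreeDecomposition.children D.root t).ncard ≤ 2 := by
  rcases D.nice t with ⟨h, -⟩ | ⟨t', v, h, -⟩ | ⟨t', v, h, -⟩ | ⟨t₁, t₂, -, h, -⟩
  · simp [h]
  · simp [h]
  · simp [h]
  · rw [h]
    exact (Set.ncard_insert_le _ _).trans (by rw [Set.ncard_singleton])

namespace RAM

/-! ### Correctness and running time -/

/-- The scheme whose states are the numbers below `m ^ (2 * m)`, the first `m` digits being the
colors and the other digits the ranks. -/
def digitScheme {n N : ℕ} (len : Fin N → ℕ) (vert : Fin N → ℕ → Fin n) (m : ℕ) :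
    Scheme (Fin n) (Fin N) where
  len := len
  vert := vert
  numStates := m ^ (2 * m)
  col σ i := σ / m ^ i % m
  rank σ i := σ / m ^ (m + i) % m

theorem digitScheme_exists_state {n N : ℕ} (len : Fin N → ℕ) (vert : Fin N → ℕ → Fin n) (m : ℕ)
    (d e : ℕ → ℕ) (hd : ∀ i < m, d i < m) (he : ∀ i < m, e i < m) :
    ∃ σ < (digitScheme len vert m).numStates, ∀ i < m,
      (digitScheme len vert m).col σ i = d i ∧ (digitScheme len vert m).rank σ i = e i := by
  obtain ⟨σ, hσ, h⟩ := exists_digits (m := m) (2 * m) (fun i => if i < m then d i else e (i - m)) (by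
    intro i hi
    split_ifs with h
    · exact hd i h
    · exact he _ (by omega))
  refine ⟨σ, hσ, fun i hi => ⟨?_, ?_⟩⟩
  · exact (h i (by omega)).trans (if_pos hi)
  · refine (h (m + i) (by omega)).trans ?_
    rw [if_neg (by omega), Nat.add_sub_cancel_left]

theorem exists_within_solve : ∃ K, ∀ {n N m k : ℕ} (G : Digraph (Fin n))
    (D : NiceTreeDecomposition G.toSimpleGraphInclusive (Fin N)) (s : State),
    (∀ v, ¬ G.Adj v v) → 1 ≤ k → k < m → 1 ≤ n → s.reg 1 = N → s.reg 2 = k →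
    s.reg 3 = D.root → s.reg 4 = n → s.reg 5 = m →
    (∀ u : Fin n, Lists (s.arr 2) (s.arr 0 u) (s.arr 1 u) {v | G.Adj u v}) →
    (∀ t : Fin N, Lists (s.arr 5) (s.arr 3 t) (s.arr 4 t)
      (D.toTreeDecomposition.children D.root t)) →
    (∀ t : Fin N, Lists (s.arr 8) (s.arr 6 t) (s.arr 7 t) {v | v ∈ D.bag t}) →
    (∀ t : Fin N, s.arr 7 t ≤ m) → (∀ p, s.arr 10 p = 0) →
    Within solve s (K * ((n + N) * (m ^ (2 * m)) ^ 7)) fun s' =>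
      (G.AcyclicColorable k → s'.reg 0 = 1) ∧ (¬ G.AcyclicColorable k → s'.reg 0 = 0) := by
  obtain ⟨K, hK⟩ := Formula.exists_time_le feasibleFormula
  refine ⟨2000 + K, ?_⟩
  intro n N m k G D s hG hk hkm hn h1 h2 h3 h4 h5 harcs hch hbags hlen h10
  choose vert hvert hinj hmem using fun t => (hbags t).exists_enum hn
  let M : Scheme (Fin n) (Fin N) := digitScheme (fun t => s.arr 7 t) vert m
  set S := m ^ (2 * m) with hS
  have hM : M.Represents D.toTreeDecomposition m :=
    { mem_bag := fun t v => hmem t v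
      vert_inj := fun t => hinj t
      len_le := hlen
      exists_state := digitScheme_exists_state _ _ m }
  -- Here `1 ≤ k < m` gives `m ≥ 2`, so that `m ^ (2 * m)` exceeds its exponent.
  have hmS : 2 * m ≤ S := (Nat.lt_pow_self (by omega)).le
  have hcard : ∀ t : Fin N, s.arr 4 t ≤ 2 := fun t =>
    (hch t).len_eq_ncard ▸ D.ncard_children_le t
  -- the runs of the parts of the program
  obtain ⟨s₁, t₁, r₁, ht₁, q₁⟩ := within_mulTable (a := 9) (cnt := 4) (stp := 4) (by decide)
    (by decide) s
  obtain ⟨s₂, t₂, r₂, ht₂, q₂⟩ := within_markArcs s₁ fun p => by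
    rw [r₁.agree.2 10 (by decide), h10]
  obtain ⟨s₃, t₃, r₃, ht₃, q₃, q₃'⟩ := within_countStates s₂
  obtain ⟨s₄, t₄, r₄, ht₄, q₄⟩ := within_mulTable (a := 11) (cnt := 7) (stp := 6) (by decide)
    (by decide) s₃
  have a₁₂ := (Runs.seq r₁ r₂).agree
  have a₁₄ := (Runs.seq r₁ (.seq r₂ (.seq r₃ r₄))).agree
  rw [a₁₂.1 5 (by decide), h5] at q₃ q₃' ht₃
  rw [← hS] at q₃'
  rw [q₃, q₃'] at q₄
  obtain ⟨s₅, t₅, r₅, ht₅, q₅⟩ := within_digitTable s₄ (by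
    rw [a₁₄.1 5 (by decide), h5]; omega) (by
    rw [r₄.agree.1 6 (by decide), q₃]; omega) (by
    rw [r₄.agree.1 6 (by decide), r₄.agree.1 7 (by decide), q₃, q₃']; exact q₄)
  rw [r₄.agree.1 6 (by decide), r₄.agree.1 7 (by decide), q₃, q₃', a₁₄.1 5 (by decide), h5] at q₅
  rw [r₄.agree.1 6 (by decide), r₄.agree.1 7 (by decide), q₃, q₃'] at ht₅
  obtain ⟨s₆, t₆, r₆, ht₆, q₆⟩ := within_mulTable (a := 13) (cnt := 1) (stp := 7) (by decide)
    (by decide) s₅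
  have a₄₅ := (Runs.seq r₄ r₅).agree
  have a₁₅ := (Runs.seq r₁ (.seq r₂ (.seq r₃ (.seq r₄ r₅)))).agree
  have a₁₆ := (Runs.seq r₁ (.seq r₂ (.seq r₃ (.seq r₄ (.seq r₅ r₆))))).agree
  rw [a₁₅.1 1 (by decide), h1, a₄₅.1 7 (by decide), q₃'] at q₆
  rw [a₁₅.1 1 (by decide), h1] at ht₆
  obtain ⟨s₇, t₇, r₇, ht₇, q₇, q₇', q₇''⟩ := within_listNodes D.toTreeDecomposition D.root s₆
    (by rw [a₁₆.1 3 (by decide), h3]) (by rw [a₁₆.1 1 (by decide), h1])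
    (by rw [a₁₆.2 3 (by decide), a₁₆.2 4 (by decide), a₁₆.2 5 (by decide)]; exact hch)
    (by rw [a₁₆.2 4 (by decide)]; exact hcard)
  have a₁₇ := (Runs.seq r₁ (.seq r₂ (.seq r₃ (.seq r₄ (.seq r₅ (.seq r₆ r₇)))))).agree
  have a₂₇ := (Runs.seq r₂ (.seq r₃ (.seq r₄ (.seq r₅ (.seq r₆ r₇))))).agree
  have a₃₇ := (Runs.seq r₃ (.seq r₄ (.seq r₅ (.seq r₆ r₇)))).agree
  have a₄₇ := (Runs.seq r₄ (.seq r₅ (.seq r₆ r₇))).agree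
  have a₅₇ := (Runs.seq r₅ (.seq r₆ r₇)).agree
  have a₆₇ := (Runs.seq r₆ r₇).agree
  rw [h4] at q₁
  rw [r₁.agree.1 4 (by decide), r₁.agree.2 0 (by decide), r₁.agree.2 1 (by decide),
    r₁.agree.2 2 (by decide), h4] at q₂
  have hadj : ∀ u v : Fin n, s₇.arr 10 (s₇.arr 9 u + v) ≠ 0 ↔ G.Adj u v := by
    intro u v
    rw [a₃₇.2 10 (by decide), a₂₇.2 9 (by decide), q₁ u u.2, q₂]
    constructor
    · rintro ⟨u', hu', j, hj, h⟩
      obtain ⟨v', hv', hj'⟩ := (harcs ⟨u', hu'⟩).exists_mem hj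
      simp only at hj'
      rw [q₁ u' hu', hj', mul_add_inj v.2 v'.2, Fin.val_inj] at h
      obtain rfl : u = ⟨u', hu'⟩ := Fin.ext h.1
      exact h.2 ▸ hv'
    · intro h
      obtain ⟨j, hj, hj'⟩ := (harcs u).mem_iff.1 h
      exact ⟨u, u.2, j, hj, by rw [q₁ u u.2, hj']⟩
  have hprep : Prepared M G (D.toTreeDecomposition.children D.root) m k s₇ :=
    { reg_two := by rw [a₁₇.1 2 (by decide), h2]
      reg_five := by rw [a₁₇.1 5 (by decide), h5]
      reg_seven := by rw [a₄₇.1 7 (by decide), q₃']; rfl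
      len := by rw [a₁₇.2 7 (by decide)]; exact fun t => rfl
      len_le := hlen
      vert := by rw [a₁₇.2 6 (by decide), a₁₇.2 8 (by decide)]; exact hvert
      adj := hadj
      col := by
        intro σ hσ i hi
        rw [a₆₇.2 12 (by decide), a₅₇.2 11 (by decide), q₄ σ hσ, q₅ σ hσ i (by omega)]
        rfl
      rank := by
        intro σ hσ i hi
        rw [a₆₇.2 12 (by decide), a₅₇.2 11 (by decide), q₄ σ hσ, q₅ σ hσ (m + i) (by omega)]
        rfl
      children := by
        rw [a₁₇.2 3 (by decide), a₁₇.2 4 (by decide), a₁₇.2 5 (by decide)]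
        exact hch
      card_children := by
        rw [a₁₇.2 4 (by decide)]
        exact hcard
      table := by
        rw [r₇.agree.2 13 (by decide)]
        exact fun t => q₆ t t.2 }
  have hMS : M.numStates = S := rfl
  obtain ⟨s₈, t₈, r₈, ht₈, q₈⟩ := within_fillTables hprep (by rw [a₁₇.1 1 (by decide), h1])
    (by omega) (by omega) q₇' q₇''
  rw [hMS] at ht₈ q₈
  have hroot := q₈ 0 (Fin.pos D.root) D.root q₇
  obtain ⟨s₉, t₉, r₉, ht₉, q₉⟩ := within_answer (s := s₈) (q := G.AcyclicColorable k)
    (r := D.root) (S := S)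
    (by rw [r₈.agree.1 3 (by decide), a₁₇.1 3 (by decide), h3])
    (by rw [r₈.agree.1 7 (by decide), hprep.reg_seven, hMS])
    (by rw [r₈.agree.2 13 (by decide), hprep.table, hMS]) (by
      constructor
      · intro h
        -- Since `k < m`, all colors are digits in base `m`.
        obtain ⟨σ, hσ, hf⟩ := hM.exists_feasible hkm.le D.root h
        exact ⟨σ, hσ, (hroot σ hσ).2 hf⟩
      · rintro ⟨σ, hσ, hf⟩
        exact hM.acyclicColorable hG ((hroot σ hσ).1 hf))
  refine ⟨s₉, _, .seq r₁ (.seq r₂ (.seq r₃ (.seq r₄ (.seq r₅ (.seq r₆ (.seq r₇ (.seq r₈ r₉))))))),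
    ?_, q₉⟩
  -- the running time
  have hsum : ∑ u ∈ Finset.range n, s.arr 1 u ≤ N * m ^ 2 := by
    rw [← Fin.sum_univ_eq_sum_range]
    refine (Finset.sum_congr rfl fun u _ => (harcs u).len_eq_ncard).trans_le
      (sum_ncard_adj_le hG D.toTreeDecomposition hM.card_bag_le)
  rw [h4] at ht₁
  rw [r₁.agree.1 4 (by decide), r₁.agree.2 1 (by decide), h4] at ht₂
  rw [q₃'] at ht₄
  -- The six nested quantifiers choose a child, its state, and two positions in each of the two
  -- bags. The loop over the states of a node supplies the seventh factor `S`.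
  have hd : feasibleFormula.depth = 6 := by decide
  have htime := hK S (by omega)
  rw [hd] at htime
  set X := (n + N) * S ^ 7 with hX
  have hpow : ∀ {j}, j ≤ 7 → S ^ j ≤ S ^ 7 := fun hj => Nat.pow_le_pow_right (by omega) hj
  have hX₀ : S ^ 7 ≤ X := Nat.le_mul_of_pos_left _ (by omega)
  have hNS : N * S ^ 7 ≤ X := Nat.mul_le_mul_right _ (by omega)
  have hnX : n + N ≤ X := Nat.le_mul_of_pos_right _ (Nat.pow_pos (by omega))
  have hSX : S ≤ X := by simpa using (hpow (j := 1) (by omega)).trans hX₀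
  have hSS : S * S ≤ X := by simpa [pow_two] using (hpow (j := 2) (by omega)).trans hX₀
  have hmS' : m ≤ S := by omega
  have hmm : m * m ≤ X := (Nat.mul_le_mul hmS' hmS').trans hSS
  have hSm : S * m ≤ X := (Nat.mul_le_mul_left S hmS').trans hSS
  have hNm : N * m ^ 2 ≤ X := (Nat.mul_le_mul_left N
    ((Nat.pow_le_pow_left hmS' 2).trans (hpow (by omega)))).trans hNS
  have hNS₁ : N * S ≤ X := by
    simpa using (Nat.mul_le_mul_left N (hpow (j := 1) (by omega))).trans hNS
  have hfill : N * (S * feasibleFormula.time S) ≤ K * X := by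
    calc N * (S * feasibleFormula.time S) ≤ N * (S * (K * S ^ 6)) := by gcongr
      _ = K * (N * S ^ 7) := by ring
      _ ≤ K * X := Nat.mul_le_mul_left K hNS
  have e₃ : 20 + 2 * m * (20 + 20 * m) = 20 + 40 * m + 40 * (m * m) := by ring
  have e₅ : 20 + S * (60 + 60 * (2 * m)) = 20 + 60 * S + 120 * (S * m) := by ring
  have e₈ : 6 + N * (S * (feasibleFormula.time S + 14) + 21) =
      6 + N * (S * feasibleFormula.time S) + 14 * (N * S) + 21 * N := by ring
  rw [e₃] at ht₃
  rw [e₅] at ht₅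
  rw [e₈] at ht₈
  rw [Nat.add_mul]
  omega

/-- With `m = w + 1` the left side is `(m ^ 14) ^ m`. For large `w` one has `m ^ 14 ≤ 27 ^ (w - 1)`,
and `(w - 1) * (w + 1) ≤ w ^ 2`. -/
theorem exists_pow_le_mul_pow :
    ∃ C, ∀ w : ℕ, ((w + 1) ^ (2 * (w + 1))) ^ 7 ≤ C * 27 ^ w ^ 2 := by
  have hlim := tendsto_pow_const_div_const_pow_of_one_lt 14 (r := (27 : ℝ)) (by norm_num)
  -- The bound `1 / 27 ^ 2`, applied at `w + 1`, leaves exactly the exponent `w - 1`.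
  have hev := hlim.eventually (gt_mem_nhds (show (0 : ℝ) < 1 / 27 ^ 2 by norm_num))
  obtain ⟨w₀, hw₀⟩ := Filter.eventually_atTop.1 hev
  -- The sum absorbs the finitely many small widths; the summand `1` makes the constant positive for
  -- the others.
  refine ⟨1 + ∑ w ∈ Finset.range (w₀ + 2), ((w + 1) ^ (2 * (w + 1))) ^ 7, fun w => ?_⟩
  have h1 : 1 ≤ 27 ^ w ^ 2 := Nat.one_le_pow _ _ (by norm_num)
  by_cases hw : w < w₀ + 2
  · have h₂ := Finset.single_le_sum (f := fun w => ((w + 1) ^ (2 * (w + 1))) ^ 7)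
      (fun _ _ => Nat.zero_le _) (Finset.mem_range.2 hw)
    exact (h₂.trans (Nat.le_add_left _ 1)).trans (Nat.le_mul_of_pos_right _ h1)
  · have h₂ := hw₀ (w + 1) (by omega)
    rw [div_lt_div_iff₀ (by positivity) (by positivity), one_mul] at h₂
    have h₃ : (w + 1) ^ 14 * 27 ^ 2 < 27 ^ (w + 1) := by exact_mod_cast h₂
    have h₄ : (w + 1) ^ 14 ≤ 27 ^ (w - 1) := by
      rw [show w + 1 = (w - 1) + 2 by omega, pow_add] at h₃
      rw [show w + 1 = (w - 1) + 2 by omega]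
      exact (Nat.lt_of_mul_lt_mul_right h₃).le
    calc ((w + 1) ^ (2 * (w + 1))) ^ 7 = ((w + 1) ^ 14) ^ (w + 1) := by
          rw [← pow_mul, ← pow_mul]
          congr 1
          ring
      _ ≤ (27 ^ (w - 1)) ^ (w + 1) := Nat.pow_le_pow_left h₄ _
      _ = 27 ^ ((w - 1) * (w + 1)) := by rw [← pow_mul]
      _ ≤ 27 ^ w ^ 2 := by
        refine Nat.pow_le_pow_right (by norm_num) ?_
        obtain ⟨v, rfl⟩ : ∃ v, w = v + 1 := ⟨w - 1, by omega⟩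
        rw [Nat.add_sub_cancel]
        nlinarith
      _ ≤ _ := Nat.le_mul_of_pos_left _ (by omega)

end RAM

/-! ### The theorem -/

theorem mainTheorem9 :
    ∃ P : RAM.Program, ∀ c : ℕ, ∃ C : ℕ,
      ∀ (n N k : ℕ) (G : Digraph (Fin n))
        (D : NiceTreeDecomposition G.toSimpleGraphInclusive (Fin N)) (s : RAM.State),
        (∀ v, ¬ G.Adj v v) → 1 ≤ k →
        N ≤ c * (max D.width 1 * n) →
        RAM.IsInput s G D k →
        RAM.DecidesWithin P s (G.AcyclicColorable k)
          (C * (k ^ D.width * 27 ^ (D.width ^ 2) * (max D.width 1) ^ 2 * n)) := by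
  obtain ⟨K, hK⟩ := RAM.exists_within_solve
  obtain ⟨C₀, hC₀⟩ := RAM.exists_pow_le_mul_pow
  -- The first summand pays for finding the largest bag, the second for the dynamic program, where
  -- `n + N ≤ (c + 1) * (max w 1 * n)`.
  refine ⟨RAM.decideColorable, fun c => ⟨60 * (c + 1) + K * C₀ * (c + 1), ?_⟩⟩
  intro n N k G D s hG hk hN hs
  set w := D.width with hw
  have hNpos : 0 < N := Fin.pos D.root
  -- A tree has a root, so `N > 0`, and the bound on `N` excludes `n = 0`.
  have hn : 1 ≤ n := by
    rcases Nat.eq_zero_or_pos n with rfl | h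
    · simp at hN
      omega
    · exact h
  have hbag : ∀ t : Fin N, s.arr 7 t = (D.bag t).card := fun t => by
    rw [(hs.bags t).len_eq_ncard, ← Set.ncard_coe_finset]
    rfl
  -- The truncated subtraction in the width is harmless because some bag is nonempty.
  have hsup : (Finset.range N).sup (s.arr 7) = w + 1 := by
    have h₁ : (Finset.range N).sup (s.arr 7) = Finset.univ.sup fun t => (D.bag t).card := by
      refine le_antisymm (Finset.sup_le fun t ht => ?_) (Finset.sup_le fun t _ => ?_)
      · rw [hbag ⟨t, Finset.mem_range.1 ht⟩]
        exact Finset.le_sup (f := fun t => (D.bag t).card) (Finset.mem_univ _)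
      · rw [← hbag t]
        exact Finset.le_sup (Finset.mem_range.2 t.2)
    obtain ⟨t, ht⟩ := D.vertex_mem ⟨0, hn⟩
    have h₂ := Finset.le_sup (f := fun t => (D.bag t).card) (Finset.mem_univ t)
    have h₃ := Finset.card_pos.2 ⟨_, ht⟩
    rw [h₁, hw, TreeDecomposition.width]
    omega
  have hle : ∀ t : Fin N, (D.bag t).card ≤ w + 1 := fun t => by
    rw [← hbag t, ← hsup]
    exact Finset.le_sup (Finset.mem_range.2 t.2)
  obtain ⟨s₁, t₁, r₁, ht₁, q₁⟩ := RAM.within_maxLen (s.setReg 4 n)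
  have e₁ : (s.setReg 4 n).reg 1 = N := by simp [hs.numNodes]
  rw [e₁, RAM.State.setReg_arr, hsup] at q₁
  rw [e₁] at ht₁
  -- Register `0` will hold truth values and the answer, so `n` is moved to register `4`.
  have r₀ : RAM.Runs (.assign 4 (.reg 0)) s (s.setReg 4 n) 2 := by
    have := RAM.Runs.assign s 4 (.reg 0)
    rwa [RAM.Expr.eval, hs.numVertices] at this
  have a₁ := r₁.agree
  have h2 : s₁.reg 2 = k := by
    rw [a₁.1 2 (by decide)]
    simp [hs.numColors]
  have harr : ∀ a, s₁.arr a = s.arr a := fun a => a₁.2 a (List.not_mem_nil)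
  set Y := k ^ w * 27 ^ w ^ 2 * (max w 1) ^ 2 * n with hY
  have hkw : 1 ≤ k ^ w := Nat.one_le_pow _ _ hk
  have h27 : 1 ≤ 27 ^ w ^ 2 := Nat.one_le_pow _ _ (by norm_num)
  have hYw : 27 ^ w ^ 2 * (max w 1 * n) ≤ Y := by
    rw [hY, pow_two (max w 1)]
    calc 27 ^ w ^ 2 * (max w 1 * n) = 1 * 27 ^ w ^ 2 * (1 * max w 1) * n := by ring
      _ ≤ _ := by gcongr; exact le_max_right _ _
  have hYw' : max w 1 * n ≤ Y := (Nat.le_mul_of_pos_left _ h27).trans hYw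
  have hnw : n ≤ max w 1 * n := Nat.le_mul_of_pos_left _ (by omega)
  have hNY : N ≤ c * Y := hN.trans (Nat.mul_le_mul_left c hYw')
  -- With at least `w + 1` colors the answer is always yes; this case split keeps the number of
  -- states independent of `k`.
  by_cases hkw' : w + 1 ≤ k
  · have hcol : G.AcyclicColorable k :=
      G.acyclicColorable_of_card_bag_le D.toTreeDecomposition hG fun t => (hle t).trans hkw'
    refine ⟨_, _, .seq r₀ (.seq r₁ (.ite_false ?_ (.assign _ _ _))), ?_, ?_⟩
    · simp only [RAM.Expr.eval, q₁, h2]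
      omega
    · simp only [RAM.Expr.cost, Nat.add_mul, Nat.mul_assoc]
      omega
    · simp [RAM.Expr.eval, hcol]
  · obtain ⟨s₂, t₂, r₂, ht₂, q₂⟩ := hK (m := w + 1) G D s₁ hG hk (by omega) hn
      (by rw [a₁.1 1 (by decide), e₁]) h2
      (by rw [a₁.1 3 (by decide)]; simp [hs.root]) (by rw [a₁.1 4 (by decide)]; simp) q₁
      (by simp only [harr]; exact hs.arcs) (by simp only [harr]; exact hs.children)
      (by simp only [harr]; exact hs.bags) (by simp only [harr, hbag]; exact hle)
      (by simp only [harr]; exact hs.arr_eq_zero 10 (by norm_num))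
    refine ⟨s₂, _, .seq r₀ (.seq r₁ (.ite_true ?_ r₂)), ?_, q₂⟩
    · simp only [RAM.Expr.eval, q₁, h2]
      omega
    · have h₃ : K * ((n + N) * ((w + 1) ^ (2 * (w + 1))) ^ 7) ≤ K * C₀ * (c + 1) * Y := by
        calc K * ((n + N) * ((w + 1) ^ (2 * (w + 1))) ^ 7)
            ≤ K * (((c + 1) * (max w 1 * n)) * (C₀ * 27 ^ w ^ 2)) := by
              gcongr
              · rw [Nat.add_mul]
                omega
              · exact hC₀ w
          _ = K * C₀ * (c + 1) * (27 ^ w ^ 2 * (max w 1 * n)) := by ring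
          _ ≤ _ := Nat.mul_le_mul_left _ hYw
      have h₄ : (60 * (c + 1) + K * C₀ * (c + 1)) * Y =
        60 * (c * Y) + 60 * Y + K * C₀ * (c + 1) * Y := by ring
      simp only [RAM.Expr.cost]
      omega
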